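/- Fix an integer $m\ge 1$ and real numbers $\delta,\delta'>-m$ (the case of interest being $\delta\neq\delta'$). For $n\ge 2$ let $V_n$ be a set with $n$ elements and let $(\delta_t)_{2\le t\le n}$ be real numbers $>-m$. The preferential attachment model with these parameters is the following random sequence of undirected multigraphs $G_t=(V_t,E_t)$, $2\le t\le n$. The graph $G_2$ has two distinct vertices chosen uniformly at random from $V_n$, joined by $m$ parallel edges. For $3\le t\le n$, the graph $G_t$ is obtained from $G_{t-1}$ by adding a vertex $v_t$ chosen uniformly at random from $V_n\setminus V_{t-1}$ and then $m$ edges, one after the other, from $v_t$ to vertices of $V_{t-1}$: the $i$-th edge goes to $v\in V_{t-1}$ with conditional probability $$\frac{\deg(v)+\delta_t}{\sum_{u\in V_{t-1}}(\deg(u)+\delta_t)},$$ where the degrees are those in the graph with the first $i-1$ edges of $v_t$ already added. Let $\mathbb P_n$ be the law of the final snapshot $G_n$ when $\delta_t=\delta$ for all $t$, and let $\mathbb Q_{n,\tau}$ be the law of $G_n$ when $\delta_t=\delta$ for $t\le\tau$ and $\delta_t=\delta'$ for $t>\tau$ (so $\mathbb P_n=\mathbb Q_{n,n}$). Let $(\tau_n)$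 be a sequence of integer changepoints with $n-\tau_n=o(\sqrt n)$ as $n\to\infty$. Then $$\operatorname{TV}(\mathbb Q_{n,n},\mathbb Q_{n,\tau_n})\to 0,$$ where $\operatorname{TV}(P,Q)=\frac12\sum_G|P(G)-Q(G)|$. Consequently every test is asymptotically powerless: for every sequence of (possibly randomized) tests $\varphi_n$, where $\varphi_n(G)\in[0,1]$ is the probability of rejecting the null hypothesis on observing the snapshot $G$, the sum of the Type-I and Type-II errors satisfies $$\mathbb E_{G\sim\mathbb P_n}[\varphi_n(G)]+\mathbb E_{G\sim\mathbb Q_{n,\tau_n}}[1-\varphi_n(G)]\to 1 .$$ -/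

import Mathlib

open Filter Topology Asymptotics

/-- An undirected multigraph on a subset `verts` of the ground set `V`; an edge between `u` and `v`
is the unordered pair `s(u, v)`, counted with multiplicity in the multiset `edges`. -/
structure PAGraph (V : Type*) where
  /-- the vertices present so far -/
  verts : Finset V
  /-- the edges, with multiplicity -/
  edges : Multiset (Sym2 V)

section Model

variable {V : Type*} [Fintype V] [DecidableEq V]

/-- The degree of `v` in a loopless multigraph with edge multiset `E`: the number of edges incident
with `v`, counted with multiplicity. (The model never creates loops.) -/
def paDegree (E : Multiset (Sym2 V)) (v : V) : ℕ :=
  E.countP (fun e => v ∈ e)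

/-- The attachment weight `deg v + d` of an old vertex `v ∈ S`; vertices outside `S` have weight
`0`. For parameters `d > -m` the number `deg v + d` is positive in every reachable graph. -/
noncomputable def attachWeight (d : ℝ) (S : Finset V) (E : Multiset (Sym2 V)) (v : V) : ENNReal :=
  if v ∈ S then ENNReal.ofReal ((paDegree E v : ℝ) + d) else 0

theorem tsum_attachWeight_ne_top (d : ℝ) (S : Finset V) (E : Multiset (Sym2 V)) :
    ∑' v, attachWeight d S E v ≠ ⊤ := by
  rw [tsum_fintype]
  refine ENNReal.sum_ne_top.2 fun v _ => ?_
  unfold attachWeight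
  split_ifs
  · exact ENNReal.ofReal_ne_top
  · exact ENNReal.zero_ne_top

open Classical in
/-- One edge step: add to `E` an edge from the new vertex `w` to a random vertex `v ∈ S`, chosen
with probability `(deg v + d) / ∑ u ∈ S, (deg u + d)`, degrees being taken in the current edge
multiset `E`. The second branch (total weight zero) is never reached in the model. -/
noncomputable def attachEdge (d : ℝ) (S : Finset V) (w : V) (E : Multiset (Sym2 V)) :
    PMF (Multiset (Sym2 V)) :=
  if h : ∑' v, attachWeight d S E v ≠ 0 then
    (PMF.normalize (attachWeight d S E) h (tsum_attachWeight_ne_top d S E)).map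
      (fun v => s(w, v) ::ₘ E)
  else PMF.pure E

/-- `i` successive edge steps from the new vertex `w` to the old vertices `S`. -/
noncomputable def attachEdges (d : ℝ) (S : Finset V) (w : V) (E : Multiset (Sym2 V)) :
    ℕ → PMF (Multiset (Sym2 V))
  | 0 => PMF.pure E
  | i + 1 => (attachEdges d S w E i).bind (attachEdge d S w)

/-- One time step: a uniformly random unused vertex `w` arrives and sends `m` edges to the old
vertices. The second branch (no unused vertex left) is never reached up to time `|V|`. -/
noncomputable def paStep (m : ℕ) (d : ℝ) (G : PAGraph V) : PMF (PAGraph V) :=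
  if h : (Finset.univ \ G.verts).Nonempty then
    (PMF.uniformOfFinset (Finset.univ \ G.verts) h).bind fun w =>
      (attachEdges d G.verts w G.edges m).map fun E => ⟨insert w G.verts, E⟩
  else PMF.pure G

/-- The law of the initial graph `G_2`: a uniformly random ordered pair of distinct vertices, joined
by `m` parallel edges. (If `|V| < 2` there is no such pair, and the value is the empty graph.) -/
noncomputable def paInit (V : Type*) [Fintype V] [DecidableEq V] (m : ℕ) : PMF (PAGraph V) :=
  if h : (Finset.univ : Finset V).offDiag.Nonempty then
    (PMF.uniformOfFinset (Finset.univ : Finset V).offDiag h).map fun p =>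
      ⟨{p.1, p.2}, Multiset.replicate m s(p.1, p.2)⟩
  else PMF.pure ⟨∅, 0⟩

/-- The law of the graph `G_t` at time `t ≥ 2` (times `0` and `1` are not used) in the preferential
attachment model with `m` edges per vertex and parameters `δ t`: the vertex arriving at time `t`
attaches with parameter `δ t`. -/
noncomputable def paLaw (V : Type*) [Fintype V] [DecidableEq V] (m : ℕ) (δ : ℕ → ℝ) :
    ℕ → PMF (PAGraph V)
  | 0 => paInit V m
  | 1 => paInit V m
  | 2 => paInit V m
  | t + 3 => (paLaw V m δ (t + 2)).bind (paStep m (δ (t + 3)))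

/-- The law of the final snapshot `G_n`, `n = |V|`, when the parameter is constantly `δ`. -/
noncomputable def nullLaw (V : Type*) [Fintype V] [DecidableEq V] (m : ℕ) (δ : ℝ) :
    PMF (PAGraph V) :=
  paLaw V m (fun _ => δ) (Fintype.card V)

/-- The law of the final snapshot `G_n`, `n = |V|`, when the parameter is `δ` up to and including
time `τ` and `δ'` afterwards. -/
noncomputable def changepointLaw (V : Type*) [Fintype V] [DecidableEq V] (m : ℕ) (δ δ' : ℝ)
    (τ : ℕ) : PMF (PAGraph V) :=
  paLaw V m (fun t => if t ≤ τ then δ else δ') (Fintype.card V)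

end Model

/-- Total variation distance of two discrete laws. -/
noncomputable def tvDist {α : Type*} (p q : PMF α) : ℝ :=
  (1 / 2) * ∑' a, |(p a).toReal - (q a).toReal|

/-- The Type-I error of the randomized test which on observing `a` rejects with probability `φ a`,
under the null law `p`. -/
noncomputable def typeIError {α : Type*} (p : PMF α) (φ : α → ℝ) : ℝ :=
  ∑' a, (p a).toReal * φ a

/-- The Type-II error of the randomized test which on observing `a` rejects with probability `φ a`,
under the alternative law `q`. -/
noncomputable def typeIIError {α : Type*} (q : PMF α) (φ : α → ℝ) : ℝ :=
  ∑' a, (q a).toReal * (1 - φ a)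

/-!
The snapshot laws with changepoints `τ` and `τ + 1` differ only in the parameter of one vertex `T`,
the one arriving at time `τ + 1`. It is shown that, in the second half of the evolution, their total
variation distance is `O(1 / √n)`. Summing over the `n - τ = o(√n)` possible positions gives the
theorem, and a test separates two laws by at most twice their total variation distance.

*An equivalent model with independent choices.* Choosing an old vertex with probability proportional
to its degree plus `δ` amounts to the following: with weight `m + δ` each, choose an old vertex, and
with weight `1` each, choose an earlier edge and copy its old endpoint. The total weight at a given
edge does not depend on the past, so the choices at the different edges are independent, and the
model is a product law (`structPMF`) together with a uniformly random labelling; this is `paLaw_eq`.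
Changing the parameter of `T` has a density `1 + X`, where the centred function `X` depends only on
which of the choices of `T` are vertices and which are edges (`mass_update`,
`sum_mass_rowDensity`).

*Exchanging arrival times.* Only the conditional expectation of `X` given the snapshot matters. Take
a window of `k` arrival times ending at `T`, and split the vertices arriving in it into clusters, the
connected components of the relation of choosing one another. For every permutation `π` of the
window, each cluster `C` may be moved to the arrival times `π C`, keeping the order inside `C`. This
preserves the law of the structure (`sum_mass_relabel`), and, the labels being uniformly random, the
law of the labelled snapshot does not notice it (`snapshot_relabel`). Taking for `π` the
transpositions of `p` and `T`, one may replace `X`, evaluated at `T`, by the average over `p` in the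
window of `X` evaluated at the last vertex of the cluster of `p`. By the same symmetry the second
moment of this average is the mean over `p` of the covariances between the value at `T` and the value
at the last vertex of the cluster of `p`. Such a covariance vanishes up to the probability that `p`
is in the cluster of `T`, because `X` is centred given all the choices of the other vertices. Hence
the second moment is at most a constant times the expected size of the cluster of `T`, divided by `k`
(`abs_sum_mass_mul_le`).

*Clusters are small.* A given choice points to a given vertex with probability `O(1 / n)`, so in a
window of length `k = ηn` with `η` small, counting simple paths bounds the expected cluster size by a
constant (`sum_mass_card_cluster_le`). The Cauchy–Schwarz inequality then yields `O(1 / √k)`, that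
is, `O(1 / √n)`.
-/

namespace PrefAttach

/-! ### Product laws and the resampling of one coordinate -/

section Product

variable {ι κ : Type*} [Fintype ι] [DecidableEq ι] [Fintype κ]

/-- The law of a family of independent random variables, the `i`-th one with law `w i`. -/
noncomputable def productPMF (w : ι → PMF κ) : PMF (ι → κ) :=
  PMF.ofFintype (fun c => ∏ i, w i (c i)) (by
    rw [← Fintype.piFinset_univ, ← Finset.prod_univ_sum]
    refine Finset.prod_eq_one fun i _ => ?_
    rw [← tsum_fintype (L := .unconditional _), (w i).tsum_coe])

theorem productPMF_apply (w : ι → PMF κ) (c : ι → κ) : productPMF w c = ∏ i, w i (c i) := rfl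

/-- Resampling the coordinate `i` leaves a sum against product weights unchanged. The proof is the
involution exchanging the old and the new value of that coordinate. -/
theorem sum_prod_resample {R : Type*} [CommSemiring R] (w : ι → κ → R) (i : ι)
    (hi : ∑ k, w i k = 1) (F : (ι → κ) → R) :
    ∑ c : ι → κ, (∏ j, w j (c j)) * ∑ k, w i k * F (Function.update c i k) =
      ∑ c : ι → κ, (∏ j, w j (c j)) * F c := by
  have key : ∀ (c : ι → κ) (k : κ),
      (∏ j, w j (Function.update c i k j)) * w i (c i) = (∏ j, w j (c j)) * w i k := by
    intro c k
    rw [← Finset.mul_prod_erase _ _ (Finset.mem_univ i),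
      ← Finset.mul_prod_erase (Finset.univ) (fun j => w j (c j)) (Finset.mem_univ i)]
    have : ∏ j ∈ Finset.univ.erase i, w j (Function.update c i k j) =
        ∏ j ∈ Finset.univ.erase i, w j (c j) := by
      refine Finset.prod_congr rfl fun j hj => ?_
      rw [Function.update_of_ne (Finset.ne_of_mem_erase hj)]
    rw [this, Function.update_self]
    ring
  calc ∑ c : ι → κ, (∏ j, w j (c j)) * ∑ k, w i k * F (Function.update c i k)
      = ∑ x : (ι → κ) × κ, (∏ j, w j (x.1 j)) * w i x.2 * F (Function.update x.1 i x.2) := by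
        rw [Fintype.sum_prod_type]
        refine Finset.sum_congr rfl fun c _ => ?_
        rw [Finset.mul_sum]
        exact Finset.sum_congr rfl fun k _ => by ring
    _ = ∑ x : (ι → κ) × κ, (∏ j, w j (x.1 j)) * w i x.2 * F x.1 := by
        refine Finset.sum_bij' (fun x _ => (Function.update x.1 i x.2, x.1 i))
          (fun x _ => (Function.update x.1 i x.2, x.1 i)) (by simp) (by simp) (by simp) (by simp) ?_
        intro x _
        simp only [key]
    _ = _ := by
        rw [Fintype.sum_prod_type]
        refine Finset.sum_congr rfl fun c _ => ?_
        dsimp only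
        rw [← Finset.sum_mul, ← Finset.mul_sum, hi, mul_one]

theorem productPMF_bind_update (w : ι → PMF κ) (i : ι) :
    ((productPMF w).bind fun c => (w i).map (Function.update c i)) = productPMF w := by
  classical
  ext b
  have h1 : ∑ k, w i k = 1 := by
    rw [← tsum_fintype (L := .unconditional _), (w i).tsum_coe]
  have := sum_prod_resample (fun j k => w j k) i h1 (fun c => if b = c then 1 else 0)
  simp only [PMF.bind_apply, PMF.map_apply, tsum_fintype, productPMF_apply]
  simp only [mul_ite, mul_one, mul_zero, Finset.sum_ite_eq, Finset.mem_univ, if_true] at this ⊢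
  rw [← this]
  refine Finset.sum_congr rfl fun c _ => ?_
  congr 1
  exact Finset.sum_congr rfl fun k _ => by congr

end Product

/-! ### Uniformly random labels -/

section Labels

variable {α V : Type*} [Fintype α] [Fintype V] [DecidableEq V] [DecidableEq α] [Nonempty (α ≃ V)]

/-- In a uniformly random labelling the label of a position `r` outside `A` is uniform among the
labels not used on `A`, given the labels on `A`. -/
theorem uniform_bind_unused {β : Type*} (A : Finset α) (r : α) (hr : r ∉ A)
    (F : (α ≃ V) → V → PMF β)
    (hF : ∀ l l' : α ≃ V, (∀ p ∈ A, l p = l' p) → F l = F l')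
    (h : ∀ l : α ≃ V, (Finset.univ \ A.image l).Nonempty) :
    ((PMF.uniformOfFintype (α ≃ V)).bind fun l => (PMF.uniformOfFinset _ (h l)).bind (F l)) =
      (PMF.uniformOfFintype (α ≃ V)).bind fun l => F l (l r) := by
  ext b
  simp only [PMF.bind_apply, tsum_fintype, PMF.uniformOfFintype_apply]
  rw [← Finset.mul_sum, ← Finset.mul_sum]
  congr 1
  have hcard : ∀ l : α ≃ V, (Finset.univ \ A.image l).card = (Finset.univ \ A).card := by
    intro l
    have : Finset.univ \ A.image l = (Finset.univ \ A).image l := by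
      ext v
      obtain ⟨p, rfl⟩ := l.surjective v
      simp
    rw [this, Finset.card_image_of_injective _ l.injective]
  have h0 : (Finset.univ \ A).card ≠ 0 :=
    Finset.card_ne_zero_of_mem (a := r) (by simpa using hr)
  have hsum : ∀ l : α ≃ V, ∑ v, PMF.uniformOfFinset _ (h l) v * F l v b =
      ((Finset.univ \ A).card : ENNReal)⁻¹ * ∑ j ∈ Finset.univ \ A, F l (l j) b := by
    intro l
    rw [← l.sum_comp, Finset.mul_sum]
    rw [← Finset.sum_subset (Finset.subset_univ (Finset.univ \ A))]
    · refine Finset.sum_congr rfl fun j hj => ?_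
      have : l j ∈ Finset.univ \ A.image l := by simpa using hj
      rw [PMF.uniformOfFinset_apply_of_mem _ this, hcard]
    · intro j _ hj
      have : l j ∉ Finset.univ \ A.image l := by simpa using hj
      rw [PMF.uniformOfFinset_apply_of_notMem _ this, zero_mul]
  simp only [hsum]
  rw [← Finset.mul_sum, Finset.sum_comm]
  have hswap : ∀ j ∈ Finset.univ \ A, ∑ l : α ≃ V, F l (l j) b = ∑ l : α ≃ V, F l (l r) b := by
    intro j hj
    refine Finset.sum_bij' (fun l _ => (Equiv.swap r j).trans l)
      (fun l _ => (Equiv.swap r j).trans l) (by simp) (by simp) ?_ ?_ ?_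
    · intro l _; ext; simp
    · intro l _; ext; simp
    · intro l _
      have : F ((Equiv.swap r j).trans l) = F l := by
        refine hF _ _ fun p hp => ?_
        have h1 : p ≠ r := fun h => hr (h ▸ hp)
        have h2 : p ≠ j := fun h => by simp at hj; exact hj (h ▸ hp)
        simp [Equiv.swap_apply_of_ne_of_ne h1 h2]
      simp [this]
  rw [Finset.sum_congr rfl hswap, Finset.sum_const, nsmul_eq_mul, ← mul_assoc,
    ENNReal.inv_mul_cancel (by exact_mod_cast h0) (ENNReal.natCast_ne_top _), one_mul]

/-- In a uniformly random labelling the labels of two distinct positions are a uniform ordered pair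
of distinct labels. -/
theorem uniform_offDiag_map {β : Type*} (a b : α) (hab : a ≠ b) (F : V × V → β)
    (h : (Finset.univ : Finset V).offDiag.Nonempty) :
    (PMF.uniformOfFinset _ h).map F =
      (PMF.uniformOfFintype (α ≃ V)).map fun l => F (l a, l b) := by
  classical
  ext y
  simp only [PMF.map_apply, tsum_fintype, PMF.uniformOfFintype_apply]
  set D := (Finset.univ : Finset α).offDiag with hD
  have hbij : ∀ (l : α ≃ V) (g : V × V → ENNReal),
      ∑ p ∈ (Finset.univ : Finset V).offDiag, g p = ∑ p ∈ D, g (l p.1, l p.2) := by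
    intro l g
    refine (Finset.sum_bij (fun p _ => (l p.1, l p.2)) ?_ ?_ ?_ ?_).symm
    · intro p hp; simpa [hD] using hp
    · rintro ⟨p, q⟩ _ ⟨p', q'⟩ _ hpq; simpa using hpq
    · rintro ⟨u, v⟩ hp
      exact ⟨(l.symm u, l.symm v), by simpa [hD] using hp, by simp⟩
    · intro p _; rfl
  obtain ⟨l0⟩ := ‹Nonempty (α ≃ V)›
  have hcard : ((Finset.univ : Finset V).offDiag.card : ENNReal) = D.card := by
    have := hbij l0 (fun _ => 1)
    simpa using this
  have hD0 : (D.card : ENNReal) ≠ 0 := by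
    rw [← hcard]; exact_mod_cast Finset.card_ne_zero.2 h
  have hperm : ∀ p ∈ D, (∑ l : α ≃ V, if y = F (l p.1, l p.2) then
      (Fintype.card (α ≃ V) : ENNReal)⁻¹ else 0) =
      ∑ l : α ≃ V, if y = F (l a, l b) then (Fintype.card (α ≃ V) : ENNReal)⁻¹ else 0 := by
    rintro ⟨p, q⟩ hp
    have hpq : p ≠ q := by simpa [hD] using hp
    obtain ⟨s, hs⟩ : ∃ s : Equiv.Perm α, s a = p ∧ s b = q := by
      refine ⟨(Equiv.swap a p).trans (Equiv.swap (Equiv.swap a p b) q), ?_, ?_⟩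
      · have h1 : Equiv.swap a p b ≠ p := fun h => hab (by
          have : Equiv.swap a p b = Equiv.swap a p a := by rw [h, Equiv.swap_apply_left]
          exact ((Equiv.swap a p).injective this).symm)
        simp [Equiv.swap_apply_of_ne_of_ne h1.symm hpq]
      · simp
    refine Finset.sum_bij' (fun l _ => s.trans l) (fun l _ => s.symm.trans l)
      (by simp) (by simp) ?_ ?_ ?_
    · intro l _; ext; simp
    · intro l _; ext; simp
    · intro l _; simp [hs.1, hs.2]
  have hl : (Fintype.card (α ≃ V) : ENNReal) ≠ 0 := by
    have : Nonempty (α ≃ V) := ⟨l0⟩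
    exact_mod_cast Fintype.card_ne_zero
  have hone : ∑ _l : α ≃ V, (Fintype.card (α ≃ V) : ENNReal)⁻¹ = 1 := by
    rw [Finset.sum_const, nsmul_eq_mul, Finset.card_univ,
      ENNReal.mul_inv_cancel hl (ENNReal.natCast_ne_top _)]
  -- average the right-hand side over all pairs of positions
  calc (∑ p : V × V, if y = F p then
PMF.uniformOfFinset _ h p else 0)
      = ∑ p ∈ (Finset.univ : Finset V).offDiag, if y = F p then (D.card : ENNReal)⁻¹ else 0 := by
        rw [← Finset.sum_subset (Finset.subset_univ (Finset.univ : Finset V).offDiag)]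
        · exact Finset.sum_congr rfl fun p hp => by
            rw [PMF.uniformOfFinset_apply_of_mem _ hp, hcard]
        · intro p _ hp; rw [PMF.uniformOfFinset_apply_of_notMem _ hp, ite_self]
    _ = ∑ l : α ≃ V, (Fintype.card (α ≃ V) : ENNReal)⁻¹ *
          ∑ p ∈ D, if y = F (l p.1, l p.2) then (D.card : ENNReal)⁻¹ else 0 := by
        have := fun l => hbij l (fun p => if y = F p then (D.card : ENNReal)⁻¹ else 0)
        rw [Finset.sum_congr rfl fun l _ => congrArg _ (this l).symm]
        rw [← Finset.sum_mul, hone, one_mul]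
    _ = (D.card : ENNReal)⁻¹ * ∑ p ∈ D, ∑ l : α ≃ V, if y = F (l p.1, l p.2) then
          (Fintype.card (α ≃ V) : ENNReal)⁻¹ else 0 := by
        rw [Finset.sum_comm, Finset.mul_sum]
        refine Finset.sum_congr rfl fun l _ => ?_
        rw [Finset.mul_sum, Finset.mul_sum]
        refine Finset.sum_congr rfl fun p _ => ?_
        split_ifs <;> ring
    _ = _ := by
        rw [Finset.sum_congr rfl hperm, Finset.sum_const, nsmul_eq_mul, ← mul_assoc,
          ENNReal.inv_mul_cancel hD0 (ENNReal.natCast_ne_top _), one_mul]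

end Labels

/-! ### Attachment structures: attaching to a vertex or copying an earlier edge -/

/-- The position of an edge in the order of its creation: `(r, i)` is the `i`-th edge sent by the
`r`-th vertex, where vertices are numbered from `0` by arrival. The slots with `r < 2` are idle, as
the first two vertices send no edges. -/
abbrev Slot (N m : ℕ) := Fin (N + 2) × Fin m

/-- A random choice made at a slot: `(j, none)` attaches the new edge to the vertex `j`, and
`(j, some i)` gives it the same old endpoint as the edge at the slot `(j, i)`. -/
abbrev Choice (N m : ℕ) := Fin (N + 2) × Option (Fin m)

variable {N m : ℕ}

/-- The place of a slot in the order of creation. -/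
def rank (e : Slot N m) : ℕ := e.1.val * m + e.2.val

/-- The choices possible at the slot `e`: an earlier vertex, or an edge created before. An idle slot
`e` has the single choice `(e.1, none)`. -/
def Admissible (e : Slot N m) (k : Choice N m) : Prop :=
  (e.1.val < 2 ∧ k = (e.1, none)) ∨
    (2 ≤ e.1.val ∧ ((k.2 = none ∧ k.1 < e.1) ∨
      ∃ i, k.2 = some i ∧ 2 ≤ k.1.val ∧ (k.1 < e.1 ∨ k.1 = e.1 ∧ i < e.2)))

open Classical in
/-- The weight of a choice: `a r` for attaching to a vertex and `1` for copying an edge, where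
`a r = m + δ` if the vertex `r` attaches with parameter `δ`. Then an old vertex of in-degree `d` is
reached with total weight `a r + d`, which is its degree plus `δ`. -/
noncomputable def weight (a : Fin (N + 2) → ℝ) (e : Slot N m) (k : Choice N m) : ℝ :=
  if Admissible e k then (if k.2 = none then a e.1 else 1) else 0

/-- The total weight of all choices at a slot. -/
noncomputable def totalWeight (a : Fin (N + 2) → ℝ) (e : Slot N m) : ℝ := ∑ k, weight a e k

/-- The probability of a choice. -/
noncomputable def prob (a : Fin (N + 2) → ℝ) (e : Slot N m) (k : Choice N m) : ℝ :=
  weight a e k / totalWeight a e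

section Weights

variable {a : Fin (N + 2) → ℝ}

theorem weight_nonneg (ha : ∀ r, 0 < a r) (e : Slot N m) (k : Choice N m) : 0 ≤ weight a e k := by
  unfold weight
  split_ifs
  · exact (ha _).le
  · exact zero_le_one
  · exact le_rfl

theorem totalWeight_pos (ha : ∀ r, 0 < a r) (e : Slot N m) : 0 < totalWeight a e := by
  obtain ⟨j, hj⟩ : ∃ j, Admissible e (j, none) := by
    by_cases h : e.1.val < 2
    · exact ⟨e.1, Or.inl ⟨h, rfl⟩⟩
    · refine ⟨0, Or.inr ⟨not_lt.1 h, Or.inl ⟨rfl, ?_⟩⟩⟩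
      rw [Fin.lt_def, Fin.val_zero]
      omega
  refine Finset.sum_pos' (fun k _ => weight_nonneg ha e k) ⟨(j, none), Finset.mem_univ _, ?_⟩
  simpa [weight, hj] using ha e.1

theorem prob_nonneg (ha : ∀ r, 0 < a r) (e : Slot N m) (k : Choice N m) : 0 ≤ prob a e k :=
  div_nonneg (weight_nonneg ha e k) (totalWeight_pos ha e).le

theorem sum_prob (ha : ∀ r, 0 < a r) (e : Slot N m) : ∑ k, prob a e k = 1 := by
  unfold prob
  rw [← Finset.sum_div]
  exact div_self (totalWeight_pos ha e).ne'

theorem admissible_of_prob_ne_zero {e : Slot N m} {k : Choice N m} (h : prob a e k ≠ 0) :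
    Admissible e k := by
  by_contra hk
  exact h (by simp [prob, weight, hk])

/-- The law of the choice at a slot. -/
noncomputable def choicePMF (ha : ∀ r, 0 < a r) (e : Slot N m) : PMF (Choice N m) :=
  PMF.ofFintype (fun k => ENNReal.ofReal (prob a e k)) (by
    rw [← ENNReal.ofReal_sum_of_nonneg fun k _ => prob_nonneg ha e k, sum_prob ha,
      ENNReal.ofReal_one])

theorem choicePMF_apply (ha : ∀ r, 0 < a r) (e : Slot N m) (k : Choice N m) :
    choicePMF ha e k = ENNReal.ofReal (prob a e k) := rfl

theorem admissible_of_mem_support (ha : ∀ r, 0 < a r) {e : Slot N m} {k : Choice N m}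
    (h : k ∈ (choicePMF ha e).support) : Admissible e k := by
  rw [PMF.mem_support_iff, choicePMF_apply] at h
  exact admissible_of_prob_ne_zero (a := a) fun h0 => h (by rw [h0, ENNReal.ofReal_zero])

end Weights

/-! ### The endpoints determined by an attachment structure -/

theorem rank_lt (e : Slot N m) : rank e < (N + 2) * m := by
  have h1 := e.1.isLt
  have h2 := e.2.isLt
  unfold rank
  nlinarith

theorem rank_lt_mul_iff (e : Slot N m) (r : ℕ) : rank e < r * m ↔ e.1.val < r := by
  have h2 := e.2.isLt
  unfold rank
  constructor
  · intro h
    by_contra hr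
    have := Nat.mul_le_mul_right m (not_lt.1 hr)
    omega
  · intro h
    have := Nat.mul_le_mul_right m (Nat.succ_le_of_lt h)
    rw [Nat.succ_mul] at this
    omega

theorem rank_lt_rank_iff (e e' : Slot N m) :
    rank e < rank e' ↔ e.1 < e'.1 ∨ e.1 = e'.1 ∧ e.2 < e'.2 := by
  rcases lt_trichotomy e.1 e'.1 with h | h | h
  · have := (rank_lt_mul_iff e e'.1.val).2 h
    have : rank e < rank e' := lt_of_lt_of_le this (by unfold rank; omega)
    simp [h, this]
  · simp [rank, h]
  · have := (rank_lt_mul_iff e' e.1.val).2 h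
    have : rank e' < rank e := lt_of_lt_of_le this (by unfold rank; omega)
    simp [h.not_gt, h.ne', this.not_gt]

theorem rank_injective : Function.Injective (rank (N := N) (m := m)) := by
  intro e e' h
  have h1 := rank_lt_rank_iff e e'
  have h2 := rank_lt_rank_iff e' e
  simp only [h, lt_self_iff_false, false_iff, not_or, not_and] at h1 h2
  have h3 : e.1 = e'.1 := le_antisymm (not_lt.1 h2.1) (not_lt.1 h1.1)
  exact Prod.ext h3 (le_antisymm (not_lt.1 (h2.2 h3.symm)) (not_lt.1 (h1.2 h3)))

theorem Admissible.rank_lt {e : Slot N m} {k : Choice N m} (h : Admissible e k) {i : Fin m}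
    (hi : k.2 = some i) : rank ((k.1, i) : Slot N m) < rank e := by
  rw [rank_lt_rank_iff]
  rcases h with ⟨_, rfl⟩ | ⟨_, ⟨h, _⟩ | ⟨i', h, _, h'⟩⟩
  · simp at hi
  · simp [hi] at h
  · rw [hi] at h
    obtain rfl := Option.some_injective _ h
    exact h'

/-- Following copied edges for at most `f` steps, the old endpoint of the edge at the slot `e`. The
value when the steps run out is irrelevant. -/
def resolve (c : Slot N m → Choice N m) : ℕ → Slot N m → Fin (N + 2)
  | 0, e => e.1
  | f + 1, e => match (c e).2 with
    | none => (c e).1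
    | some i => resolve c f ((c e).1, i)

/-- The old endpoint of the edge at the slot `e`: the number of steps allowed suffices to resolve
all copies. -/
def endpoint (c : Slot N m → Choice N m) (e : Slot N m) : Fin (N + 2) :=
  resolve c ((N + 2) * m) e

/-- The endpoint reached by the choice `k` when the other slots carry the structure `c`. -/
def reach (c : Slot N m → Choice N m) (k : Choice N m) : Fin (N + 2) :=
  match k.2 with
  | none => k.1
  | some i => endpoint c (k.1, i)

section Endpoint

variable {c : Slot N m → Choice N m}

theorem resolve_eq (hc : ∀ e, Admissible e (c e)) :
    ∀ (f f' : ℕ) (e : Slot N m), rank e < f → rank e < f' → resolve c f e = resolve c f' e := by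
  intro f
  induction f with
  | zero => intro f' e h; omega
  | succ f ih =>
    intro f' e h h'
    obtain ⟨f', rfl⟩ : ∃ g, f' = g + 1 := ⟨f' - 1, by omega⟩
    simp only [resolve]
    rcases hk : (c e).2 with _ | i
    · rfl
    · have := (hc e).rank_lt hk
      exact ih _ _ (by omega) (by omega)

theorem endpoint_eq (hc : ∀ e, Admissible e (c e)) (e : Slot N m) :
    endpoint c e = reach c (c e) := by
  have h := rank_lt e
  have : endpoint c e = resolve c ((N + 2) * m + 1) e := resolve_eq hc _ _ _ h (by omega)
  rw [this]
  rfl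

/-- Edges lead to vertices that arrived earlier. The bound `n` on the rank serves the induction. -/
theorem endpoint_lt (hc : ∀ e, Admissible e (c e)) :
    ∀ (n : ℕ) (e : Slot N m), rank e < n → 2 ≤ e.1.val → endpoint c e < e.1 := by
  intro n
  induction n with
  | zero => intro e h; omega
  | succ n ih =>
    intro e h h2
    rw [endpoint_eq hc, reach]
    rcases hc e with ⟨h', _⟩ | ⟨_, ⟨hk, hlt⟩ | ⟨i, hk, hk2, _⟩⟩
    · omega
    · simpa [hk] using hlt
    · have hr := (hc e).rank_lt hk
      simp only [hk]
      refine lt_of_lt_of_le (ih ((c e).1, i) (by omega) hk2) ?_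
      rw [rank_lt_rank_iff] at hr
      rcases hr with hr | hr
      · exact hr.le
      · exact hr.1.le

theorem resolve_update (hc : ∀ e, Admissible e (c e)) (e₀ : Slot N m) (k : Choice N m) :
    ∀ (f : ℕ) (e : Slot N m), rank e < rank e₀ →
      resolve (Function.update c e₀ k) f e = resolve c f e := by
  intro f
  induction f with
  | zero => intro e _; rfl
  | succ f ih =>
    intro e h
    have hne : e ≠ e₀ := fun h' => by simp [h'] at h
    simp only [resolve, Function.update_of_ne hne]
    rcases hk : (c e).2 with _ | i
    · rfl
    · exact ih _ (((hc e).rank_lt hk).trans h)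

end Endpoint

/-! ### The snapshots determined by labels and an attachment structure -/

section Snapshot

variable {V : Type*}

/-- The slots with rank below `M` which are not idle. -/
def slotsBelow (N m M : ℕ) : Finset (Slot N m) :=
  Finset.univ.filter fun e => 2 ≤ e.1.val ∧ rank e < M

/-- The edges present before those at the slots of rank `M` and above. -/
def edgesBelow (l : Fin (N + 2) ≃ V) (c : Slot N m → Choice N m) (M : ℕ) : Multiset (Sym2 V) :=
  Multiset.replicate m s(l 0, l 1) +
    (slotsBelow N m M).val.map fun e => s(l e.1, l (endpoint c e))

/-- The labels of the first `r` vertices. -/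
def vertsBelow [DecidableEq V] (l : Fin (N + 2) ≃ V) (r : ℕ) : Finset V :=
  (Finset.univ.filter fun p : Fin (N + 2) => p.val < r).image l

/-- The graph formed by the first `r` vertices and their edges. -/
def snapshot [DecidableEq V] (l : Fin (N + 2) ≃ V) (c : Slot N m → Choice N m) (r : ℕ) : PAGraph V :=
  ⟨vertsBelow l r, edgesBelow l c (r * m)⟩

theorem mem_vertsBelow [DecidableEq V] (l : Fin (N + 2) ≃ V) (r : ℕ) (p : Fin (N + 2)) :
    l p ∈ vertsBelow l r ↔ p.val < r := by
  simp [vertsBelow]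

theorem slotsBelow_succ (e : Slot N m) (he : 2 ≤ e.1.val) :
    slotsBelow N m (rank e + 1) = insert e (slotsBelow N m (rank e)) := by
  ext e'
  simp only [slotsBelow, Finset.mem_filter, Finset.mem_univ, true_and, Finset.mem_insert,
    Nat.lt_succ_iff_lt_or_eq]
  constructor
  · rintro ⟨h, h' | h'⟩
    · exact Or.inr ⟨h, h'⟩
    · exact Or.inl (rank_injective h')
  · rintro (rfl | ⟨h, h'⟩)
    · exact ⟨he, Or.inr rfl⟩
    · exact ⟨h, Or.inl h'⟩

theorem endpoint_update_self {c : Slot N m → Choice N m} (hc : ∀ e, Admissible e (c e))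
    (e : Slot N m) (k : Choice N m) (hk : Admissible e k) :
    endpoint (Function.update c e k) e = reach c k := by
  have hc' : ∀ e', Admissible e' (Function.update c e k e') := by
    intro e'
    by_cases h : e' = e
    · subst h; simpa using hk
    · simpa [Function.update_of_ne h] using hc e'
  rw [endpoint_eq hc', Function.update_self, reach, reach]
  rcases h : k.2 with _ | i
  · rfl
  · exact resolve_update hc _ _ _ _ (hk.rank_lt h)

theorem edgesBelow_update (l : Fin (N + 2) ≃ V) {c : Slot N m → Choice N m}
    (hc : ∀ e, Admissible e (c e)) (e : Slot N m) (he : 2 ≤ e.1.val) (k : Choice N m)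
    (hk : Admissible e k) :
    edgesBelow l (Function.update c e k) (rank e + 1) =
      s(l e.1, l (reach c k)) ::ₘ edgesBelow l c (rank e) := by
  have hne : e ∉ slotsBelow N m (rank e) := by simp [slotsBelow]
  unfold edgesBelow
  rw [slotsBelow_succ e he, Finset.insert_val_of_notMem hne, Multiset.map_cons,
    endpoint_update_self hc e k hk, Multiset.add_cons]
  congr 2
  refine Multiset.map_congr rfl fun e' he' => ?_
  have : rank e' < rank e := by
    have : e' ∈ slotsBelow N m (rank e) := he'
    simp only [slotsBelow, Finset.mem_filter] at this
    exact this.2.2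
  rw [endpoint, resolve_update hc _ _ _ _ this, endpoint]

/-- The degree of an old vertex is `m` plus its in-degree. The initial two vertices, which send no
edges, have the `m` initial edges instead. -/
theorem paDegree_edgesBelow [DecidableEq V] (l : Fin (N + 2) ≃ V) {c : Slot N m → Choice N m}
    (hc : ∀ e, Admissible e (c e)) (e : Slot N m) (j : Fin (N + 2))
    (hj : j < e.1) :
    paDegree (edgesBelow l c (rank e)) (l j) =
      m + ((slotsBelow N m (rank e)).filter fun e' => endpoint c e' = j).card := by
  classical
  unfold paDegree edgesBelow
  rw [Multiset.countP_add, Multiset.countP_map]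
  have hsplit : (Multiset.filter (fun e' : Slot N m => l j ∈ s(l e'.1, l (endpoint c e')))
      (slotsBelow N m (rank e)).val).card =
      ((slotsBelow N m (rank e)).filter fun e' => e'.1 = j).card +
      ((slotsBelow N m (rank e)).filter fun e' => endpoint c e' = j).card := by
    rw [← Finset.card_union_of_disjoint]
    · rw [← Finset.filter_or, ← Finset.filter_val, Finset.card_val]
      congr 1
      ext e'
      simp [eq_comm]
    · rw [Finset.disjoint_filter]
      intro e' he' h1 h2
      have h3 := endpoint_lt hc _ e' (Nat.lt_succ_self _) (by
        simp only [slotsBelow, Finset.mem_filter] at he'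
        exact he'.2.1)
      rw [h1, h2] at h3
      exact lt_irrefl _ h3
  rw [hsplit, ← add_assoc]
  congr 1
  by_cases hj2 : j.val < 2
  · have h1 : ((slotsBelow N m (rank e)).filter fun e' => e'.1 = j) = ∅ := by
      refine Finset.filter_eq_empty_iff.2 fun e' he' h => ?_
      simp only [slotsBelow, Finset.mem_filter, h] at he'
      omega
    have h2 : l j ∈ s(l 0, l 1) := by
      have : j = 0 ∨ j = 1 := by
        rcases (by omega : j.val = 0 ∨ j.val = 1) with h | h
        · exact Or.inl (Fin.ext h)
        · exact Or.inr (Fin.ext h)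
      rcases this with rfl | rfl <;> simp
    rw [h1, Finset.card_empty, add_zero, Multiset.countP_eq_card.2, Multiset.card_replicate]
    intro x hx
    rwa [Multiset.eq_of_mem_replicate hx]
  · have h2 : l j ∉ s(l 0, l 1) := by
      simp only [Sym2.mem_iff, l.injective.eq_iff, not_or]
      constructor
      · rintro rfl; simp at hj2
      · rintro rfl; simp at hj2
    have h1 : ((slotsBelow N m (rank e)).filter fun e' => e'.1 = j) =
        (Finset.univ : Finset (Fin m)).map ⟨fun i => (j, i), fun _ _ h => by simpa using h⟩ := by
      ext e'
      simp only [slotsBelow, Finset.mem_filter, Finset.mem_univ, true_and, Finset.mem_map]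
      constructor
      · rintro ⟨_, rfl⟩
        exact ⟨e'.2, rfl⟩
      · rintro ⟨i, rfl⟩
        exact ⟨⟨not_lt.1 hj2, (rank_lt_rank_iff _ _).2 (Or.inl hj)⟩, rfl⟩
    rw [h1, Finset.card_map, Finset.card_univ, Fintype.card_fin, Multiset.countP_eq_zero.2,
      zero_add]
    intro x hx
    rwa [Multiset.eq_of_mem_replicate hx]

/-- The choices reaching the vertex labelled `v` carry together the attachment weight of `v`. -/
theorem attachWeight_eq_sum [Fintype V] [DecidableEq V] (l : Fin (N + 2) ≃ V) {c : Slot N m → Choice N m}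
    (hc : ∀ e, Admissible e (c e)) (e : Slot N m) (he : 2 ≤ e.1.val) {a : Fin (N + 2) → ℝ}
    (d : ℝ) (hd : a e.1 = m + d) (v : V) :
    attachWeight d (vertsBelow l e.1.val) (edgesBelow l c (rank e)) v =
      ENNReal.ofReal (∑ k, if v = l (reach c k) then weight a e k else 0) := by
  classical
  obtain ⟨j, rfl⟩ := l.surjective v
  have hadm0 : ∀ j', Admissible e (j', none) ↔ j' < e.1 := by
    intro j'
    constructor
    · rintro (⟨h, _⟩ | ⟨_, ⟨_, h⟩ | ⟨i, h, _⟩⟩)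
      · omega
      · exact h
      · simp at h
    · exact fun h => Or.inr ⟨he, Or.inl ⟨rfl, h⟩⟩
  have hadm1 : ∀ e' : Slot N m, Admissible e (e'.1, some e'.2) ↔ e' ∈ slotsBelow N m (rank e) := by
    intro e'
    simp only [slotsBelow, Finset.mem_filter, Finset.mem_univ, true_and]
    constructor
    · intro h
      refine ⟨?_, h.rank_lt rfl⟩
      rcases h with ⟨h, _⟩ | ⟨_, ⟨h, _⟩ | ⟨i, _, h, _⟩⟩
      · omega
      · simp at h
      · exact h
    · rintro ⟨h1, h2⟩
      exact Or.inr ⟨he, Or.inr ⟨e'.2, rfl, h1, (rank_lt_rank_iff _ _).1 h2⟩⟩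
  have hsum : (∑ k, if l j = l (reach c k) then weight a e k else 0) =
      (if j < e.1 then a e.1 else 0) +
        ((slotsBelow N m (rank e)).filter fun e' => endpoint c e' = j).card := by
    rw [Fintype.sum_prod_type]
    simp only [Fintype.sum_option, Finset.sum_add_distrib]
    congr 1
    · simp only [reach, l.injective.eq_iff, weight, hadm0, if_true]
      simp
    · rw [← Fintype.sum_prod_type' (f := fun j' i =>
        if l j = l (reach c (j', some i)) then weight a e (j', some i) else 0),
        Finset.card_filter, Nat.cast_sum,
        ← Finset.sum_subset (Finset.subset_univ (slotsBelow N m (rank e)))]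
      · refine Finset.sum_congr rfl fun e' he' => ?_
        simp [reach, weight, (hadm1 e').2 he', eq_comm]
      · intro e' _ he'
        simp [weight, mt (hadm1 e').1 he']
  rw [hsum]
  by_cases hj : j < e.1
  · rw [attachWeight, if_pos ((mem_vertsBelow _ _ _).2 hj), if_pos hj,
      paDegree_edgesBelow l hc e j hj, hd]
    congr 1
    push_cast
    ring
  · rw [attachWeight, if_neg (mt (mem_vertsBelow _ _ _).1 hj), if_neg hj, Finset.card_eq_zero.2]
    · simp
    · refine Finset.filter_eq_empty_iff.2 fun e' he' h => hj ?_
      simp only [slotsBelow, Finset.mem_filter, rank_lt_rank_iff] at he'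
      rw [← h]
      refine lt_of_lt_of_le (endpoint_lt hc _ e' (Nat.lt_succ_self _) he'.2.1) ?_
      rcases he'.2.2 with h | h
      · exact h.le
      · exact h.1.le

/-- A law proportional to the image of finitely many weights is the image of the normalized
weights. -/
theorem normalize_eq_map [Fintype V] [DecidableEq V] {κ : Type*} [Fintype κ] (g : V → ENNReal) (f : κ → V)
    (ω : κ → ℝ) (hω : ∀ k, 0 ≤ ω k) (hpos : 0 < ∑ k, ω k)
    (hg : ∀ v, g v = ENNReal.ofReal (∑ k, if v = f k then ω k else 0)) (q : PMF κ)
    (hq : ∀ k, q k = ENNReal.ofReal (ω k / ∑ k, ω k)) :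
    ∃ (h0 : ∑' v, g v ≠ 0), ∀ h1, PMF.normalize g h0 h1 = q.map f := by
  have hsum : ∑' v, g v = ENNReal.ofReal (∑ k, ω k) := by
    rw [tsum_fintype]
    simp only [hg]
    rw [← ENNReal.ofReal_sum_of_nonneg, Finset.sum_comm]
    · congr 1
      refine Finset.sum_congr rfl fun k _ => ?_
      simp
    · intro v _
      exact Finset.sum_nonneg fun k _ => by split_ifs <;> simp [hω]
  refine ⟨by rw [hsum]; simpa using hpos, fun h1 => ?_⟩
  ext v
  rw [PMF.normalize_apply, hsum, PMF.map_apply, tsum_fintype, hg,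
    ENNReal.ofReal_sum_of_nonneg fun k _ => by split_ifs <;> simp [hω], Finset.sum_mul]
  refine Finset.sum_congr rfl fun k _ => ?_
  split_ifs
  · rw [hq, ENNReal.ofReal_div_of_pos hpos, div_eq_mul_inv]
  · simp

theorem map_congr_support {α β : Type*} (p : PMF α) (f g : α → β)
    (h : ∀ x ∈ p.support, f x = g x) : p.map f = p.map g := by
  classical
  ext b
  simp only [PMF.map_apply]
  refine tsum_congr fun x => ?_
  by_cases hx : p x = 0
  · simp [hx]
  · rw [h x ((PMF.mem_support_iff _ _).2 hx)]

theorem bind_congr_support {α β : Type*} (p : PMF α) (f g : α → PMF β)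
    (h : ∀ x ∈ p.support, f x = g x) : p.bind f = p.bind g := by
  ext b
  simp only [PMF.bind_apply]
  refine tsum_congr fun x => ?_
  by_cases hx : p x = 0
  · simp [hx]
  · rw [h x ((PMF.mem_support_iff _ _).2 hx)]

/-- One edge step is the random choice at one slot. -/
theorem attachEdge_eq_map [Fintype V] [DecidableEq V] (l : Fin (N + 2) ≃ V) {c : Slot N m → Choice N m}
    (hc : ∀ e, Admissible e (c e)) (e : Slot N m) (he : 2 ≤ e.1.val) {a : Fin (N + 2) → ℝ}
    (ha : ∀ r, 0 < a r) (d : ℝ) (hd : a e.1 = m + d) :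
    attachEdge d (vertsBelow l e.1.val) (l e.1) (edgesBelow l c (rank e)) =
      (choicePMF ha e).map fun k => edgesBelow l (Function.update c e k) (rank e + 1) := by
  obtain ⟨h0, h1⟩ := normalize_eq_map _ (fun k => l (reach c k)) (weight a e) (weight_nonneg ha e)
    (totalWeight_pos ha e) (attachWeight_eq_sum l hc e he d hd) (choicePMF ha e)
    (fun k => rfl)
  rw [attachEdge, dif_pos h0, h1, PMF.map_comp]
  refine map_congr_support _ _ _ fun k hk => ?_
  rw [edgesBelow_update l hc e he k (admissible_of_mem_support ha hk)]
  rfl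

/-- The law of the attachment structure. -/
noncomputable def structPMF (m : ℕ) {a : Fin (N + 2) → ℝ} (ha : ∀ r, 0 < a r) :
    PMF (Slot N m → Choice N m) :=
  productPMF (choicePMF ha)

theorem admissible_of_mem_support_structPMF {a : Fin (N + 2) → ℝ} (ha : ∀ r, 0 < a r)
    {c : Slot N m → Choice N m} (h : c ∈ (structPMF m ha).support) (e : Slot N m) :
    Admissible e (c e) := by
  rw [PMF.mem_support_iff, structPMF, productPMF_apply, Finset.prod_ne_zero_iff] at h
  exact admissible_of_mem_support ha ((PMF.mem_support_iff _ _).2 (h e (Finset.mem_univ e)))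

/-- The edges sent by the vertex `r` arise from the random choices at its slots. -/
theorem attachEdges_structPMF [Fintype V] [DecidableEq V] (l : Fin (N + 2) ≃ V) {a : Fin (N + 2) → ℝ} (ha : ∀ r, 0 < a r)
    (r : Fin (N + 2)) (hr : 2 ≤ r.val) (d : ℝ) (hd : a r = m + d) :
    ∀ i ≤ m, ((structPMF m ha).bind fun c =>
        attachEdges d (vertsBelow l r.val) (l r) (edgesBelow l c (r.val * m)) i) =
      (structPMF m ha).map fun c => edgesBelow l c (r.val * m + i) := by
  intro i
  induction i with
  | zero =>
    intro _
    simp only [attachEdges, add_zero]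
    exact PMF.bind_pure_comp _ _
  | succ i ih =>
    intro hi
    simp only [attachEdges]
    rw [← PMF.bind_bind, ih (by omega), PMF.bind_map]
    set e : Slot N m := (r, ⟨i, hi⟩) with he
    have hstep : ∀ c ∈ (structPMF m ha).support,
        (attachEdge d (vertsBelow l r.val) (l r) ∘ fun c => edgesBelow l c (r.val * m + i)) c =
        ((choicePMF ha e).map (Function.update c e)).map
          (fun c => edgesBelow l c (r.val * m + (i + 1))) := by
      intro c hc
      rw [PMF.map_comp]
      exact attachEdge_eq_map l (admissible_of_mem_support_structPMF ha hc) e hr ha d hd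
    rw [bind_congr_support _ _ _ hstep, ← PMF.map_bind, structPMF, productPMF_bind_update]

end Snapshot

/-! ### The law of the model -/

section Law

variable {V : Type*}

theorem edgesBelow_congr {l l' : Fin (N + 2) ≃ V} {r : ℕ}
    (hl : ∀ p : Fin (N + 2), p.val < r → l p = l' p) (hr : 2 ≤ r) {c : Slot N m → Choice N m}
    (hc : ∀ e, Admissible e (c e)) : edgesBelow l c (r * m) = edgesBelow l' c (r * m) := by
  unfold edgesBelow
  rw [hl 0 (by simp; omega), hl 1 (by simp; omega)]
  congr 1
  refine Multiset.map_congr rfl fun e he => ?_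
  have he' : e ∈ slotsBelow N m (r * m) := he
  simp only [slotsBelow, Finset.mem_filter, rank_lt_mul_iff] at he'
  have h1 := endpoint_lt hc _ e (Nat.lt_succ_self _) he'.2.1
  rw [hl _ he'.2.2, hl _ (lt_trans h1 he'.2.2)]

/-- The law of `G_t` in the model is the law of the snapshot at time `t` of a random attachment
structure with uniformly random labels. -/
theorem paLaw_eq [Fintype V] [DecidableEq V] (hcard : Fintype.card V = N + 2) [Nonempty (Fin (N + 2) ≃ V)]
    {a : Fin (N + 2) → ℝ} (ha : ∀ r, 0 < a r) (δ : ℕ → ℝ)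
    (hδ : ∀ r : Fin (N + 2), 2 ≤ r.val → a r = m + δ (r.val + 1)) :
    ∀ t, t ≤ N → paLaw V m δ (t + 2) =
      (PMF.uniformOfFintype (Fin (N + 2) ≃ V)).bind fun l =>
        (structPMF m ha).map fun c => snapshot l c (t + 2) := by
  intro t
  induction t with
  | zero =>
    intro _
    have hne : (Finset.univ : Finset V).offDiag.Nonempty := by
      rw [← Finset.card_pos, Finset.offDiag_card, Finset.card_univ, hcard]
      have : (N + 2) * (N + 2) = (N + 2) + (N + 1) * (N + 2) := by ring
      rw [this, Nat.add_sub_cancel_left]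
      positivity
    have h01 : (0 : Fin (N + 2)) ≠ 1 := by simp
    have hsnap : ∀ (l : Fin (N + 2) ≃ V) (c : Slot N m → Choice N m),
        snapshot l c 2 = ⟨{l 0, l 1}, Multiset.replicate m s(l 0, l 1)⟩ := by
      intro l c
      have h1 : slotsBelow N m (2 * m) = ∅ := by
        refine Finset.filter_eq_empty_iff.2 fun e _ h => ?_
        rw [rank_lt_mul_iff] at h
        omega
      have h2 : vertsBelow l 2 = {l 0, l 1} := by
        ext v
        obtain ⟨p, rfl⟩ := l.surjective v
        rw [mem_vertsBelow]
        simp only [Finset.mem_insert, Finset.mem_singleton, l.injective.eq_iff, Fin.ext_iff,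
          Fin.val_zero, Fin.val_one]
        omega
      simp [snapshot, h2, edgesBelow, h1]
    simp only [hsnap, zero_add]
    change paInit V m = _
    rw [paInit, dif_pos hne, uniform_offDiag_map (0 : Fin (N + 2)) 1 h01]
    rw [← PMF.bind_pure_comp]
    congr 1
    funext l
    exact (PMF.map_const _ _).symm
  | succ t ih =>
    intro ht
    change (paLaw V m δ (t + 2)).bind (paStep m (δ (t + 3))) = _
    rw [ih (by omega), PMF.bind_bind]
    set r : Fin (N + 2) := ⟨t + 2, by omega⟩ with hr
    set A : Finset (Fin (N + 2)) := Finset.univ.filter fun p => p.val < t + 2 with hA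
    have hrA : r ∉ A := by simp [hA, hr]
    have hne : ∀ l : Fin (N + 2) ≃ V, (Finset.univ \ A.image l).Nonempty := fun l =>
      ⟨l r, by simpa using hrA⟩
    set F : (Fin (N + 2) ≃ V) → V → PMF (PAGraph V) := fun l w =>
      (structPMF m ha).bind fun c =>
        (attachEdges (δ (t + 3)) (vertsBelow l (t + 2)) w (edgesBelow l c ((t + 2) * m)) m).map
          fun E => ⟨insert w (vertsBelow l (t + 2)), E⟩ with hF
    have h1 : ∀ l : Fin (N + 2) ≃ V,
        ((structPMF m ha).map fun c => snapshot l c (t + 2)).bind (paStep m (δ (t + 3))) =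
        (PMF.uniformOfFinset _ (hne l)).bind (F l) := by
      intro l
      rw [PMF.bind_map, hF, PMF.bind_comm]
      congr 1
      funext c
      have : (Finset.univ \ (snapshot l c (t + 2)).verts).Nonempty := hne l
      rw [Function.comp_apply, paStep, dif_pos this]
      rfl
    simp only [h1]
    rw [uniform_bind_unused A r hrA F ?_ hne]
    · congr 1
      funext l
      have hm := attachEdges_structPMF l ha r (by simp [hr]) (δ (t + 3)) (hδ r (by simp [hr])) m
        le_rfl
      have hv : insert (l r) (vertsBelow l (t + 2)) = vertsBelow l (t + 3) := by
        ext v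
        obtain ⟨p, rfl⟩ := l.surjective v
        rw [Finset.mem_insert, mem_vertsBelow, mem_vertsBelow, l.injective.eq_iff, hr,
          Fin.ext_iff]
        simp only
        omega
      rw [hF]
      simp only
      rw [← PMF.map_bind]
      change PMF.map _ ((structPMF m ha).bind fun c => attachEdges (δ (t + 3))
        (vertsBelow l r.val) (l r) (edgesBelow l c (r.val * m)) m) = _
      rw [hm, PMF.map_comp]
      congr 1
      funext c
      simp only [Function.comp_apply, snapshot, hv]
      have : r.val * m + m = (t + 1 + 2) * m := by simp only [hr]; ring
      rw [this]
    · intro l l' hll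
      have hll' : ∀ p : Fin (N + 2), p.val < t + 2 → l p = l' p := fun p hp =>
        hll p (by simpa [hA] using hp)
      have hv : vertsBelow l (t + 2) = vertsBelow l' (t + 2) := by
        refine Finset.image_congr fun p hp => hll' p (by simpa using hp)
      funext w
      rw [hF]
      refine bind_congr_support _ _ _ fun c hc => ?_
      rw [hv, edgesBelow_congr hll' (by omega) (admissible_of_mem_support_structPMF ha hc)]

end Law

/-! ### Rearranging a partitioned linear order along a permutation -/

section Transport

variable {α : Type*}

section

variable [LinearOrder α]

/-- The increasing bijection of `A` onto its image under `π`, extended by the identity. -/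
noncomputable def sortMap (π : Equiv.Perm α) (A : Finset α) (p : α) : α :=
  if h : p ∈ A then
    (A.map π.toEmbedding).orderEmbOfFin (A.card_map _) ((A.orderIsoOfFin rfl).symm ⟨p, h⟩)
  else p

theorem sortMap_mem (π : Equiv.Perm α) {A : Finset α} {p : α} (h : p ∈ A) :
    sortMap π A p ∈ A.map π.toEmbedding := by
  rw [sortMap, dif_pos h]
  exact Finset.orderEmbOfFin_mem _ _ _

theorem sortMap_lt (π : Equiv.Perm α) {A : Finset α} {p q : α} (hp : p ∈ A) (hq : q ∈ A)
    (h : p < q) : sortMap π A p < sortMap π A q := by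
  rw [sortMap, dif_pos hp, sortMap, dif_pos hq]
  simpa using h

theorem eq_self_of_strictMonoOn {A : Finset α} {f : α → α} (hf : ∀ p ∈ A, f p ∈ A)
    (hmono : ∀ p ∈ A, ∀ q ∈ A, p < q → f p < f q) {p : α} (hp : p ∈ A) : f p = p := by
  have hinj : Set.InjOn f A := by
    intro x hx y hy hxy
    rcases lt_trichotomy x y with h | h | h
    · exact absurd hxy (hmono x hx y hy h).ne
    · exact h
    · exact absurd hxy (hmono y hy x hx h).ne'
  rcases lt_trichotomy (f p) p with h | h | h
  · exfalso
    have h1 : (A.filter (· < p)).card ≤ (A.filter (· < f p)).card := by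
      refine Finset.card_le_card_of_injOn f (fun q hq => ?_) (fun x hx y hy => ?_)
      · simp only [Finset.coe_filter, Set.mem_ofPred_eq] at hq ⊢
        exact ⟨hf q hq.1, hmono q hq.1 p hp hq.2⟩
      · simp only [Finset.coe_filter, Set.mem_ofPred_eq] at hx hy
        exact hinj hx.1 hy.1
    have h2 : A.filter (· < f p) ⊂ A.filter (· < p) := by
      refine (Finset.ssubset_iff_of_subset fun q hq => ?_).2 ⟨f p, ?_, ?_⟩
      · simp only [Finset.mem_filter] at hq ⊢
        exact ⟨hq.1, hq.2.trans h⟩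
      · simpa using ⟨hf p hp, h⟩
      · simp
    exact (Finset.card_lt_card h2).not_ge h1
  · exact h
  · exfalso
    have h1 : (A.filter (p < ·)).card ≤ (A.filter (f p < ·)).card := by
      refine Finset.card_le_card_of_injOn f (fun q hq => ?_) (fun x hx y hy => ?_)
      · simp only [Finset.coe_filter, Set.mem_ofPred_eq] at hq ⊢
        exact ⟨hf q hq.1, hmono p hp q hq.1 hq.2⟩
      · simp only [Finset.coe_filter, Set.mem_ofPred_eq] at hx hy
        exact hinj hx.1 hy.1
    have h2 : A.filter (f p < ·) ⊂ A.filter (p < ·) := by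
      refine (Finset.ssubset_iff_of_subset fun q hq => ?_).2 ⟨f p, ?_, ?_⟩
      · simp only [Finset.mem_filter] at hq ⊢
        exact ⟨hq.1, h.trans hq.2⟩
      · simpa using ⟨hf p hp, h⟩
      · simp
    exact (Finset.card_lt_card h2).not_ge h1

end

section

variable [Fintype α]

open Classical in
/-- The equivalence class of `p` as a finite set. -/
noncomputable def cls (S : Setoid α) (p : α) : Finset α := Finset.univ.filter fun q => S p q

theorem mem_cls {S : Setoid α} {p q : α} : q ∈ cls S p ↔ S p q := by simp [cls]

theorem self_mem_cls (S : Setoid α) (p : α) : p ∈ cls S p := mem_cls.2 (S.refl p)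

theorem cls_eq {S : Setoid α} {p q : α} (h : S p q) : cls S p = cls S q := by
  ext x
  rw [mem_cls, mem_cls]
  exact ⟨fun hx => S.trans (S.symm h) hx, fun hx => S.trans h hx⟩

end

variable [Fintype α] [LinearOrder α]

theorem transport_injective (S : Setoid α) (π : Equiv.Perm α) :
    Function.Injective fun p => sortMap π (cls S p) p := by
  intro p q h
  simp only at h
  have hp := sortMap_mem π (self_mem_cls S p)
  have hq := sortMap_mem π (self_mem_cls S q)
  rw [← h] at hq
  obtain ⟨x, hx, hx'⟩ := Finset.mem_map.1 hp
  obtain ⟨y, hy, hy'⟩ := Finset.mem_map.1 hq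
  have hxy : x = y := π.injective (hx'.trans hy'.symm)
  subst hxy
  have hpq : S p q := S.trans (mem_cls.1 hx) (S.symm (mem_cls.1 hy))
  rw [← cls_eq hpq] at h
  have hq' : q ∈ cls S p := mem_cls.2 hpq
  rcases lt_trichotomy p q with h' | h' | h'
  · exact absurd h (sortMap_lt π (self_mem_cls S p) hq' h').ne
  · exact h'
  · exact absurd h (sortMap_lt π hq' (self_mem_cls S p) h').ne'

/-- The permutation mapping each class `C` of the partition `S` increasingly onto `π C`. -/
noncomputable def transport (S : Setoid α) (π : Equiv.Perm α) : Equiv.Perm α :=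
  Equiv.ofBijective (fun p => sortMap π (cls S p) p)
    (Finite.injective_iff_bijective.1 (transport_injective S π))

variable {S : Setoid α} {π : Equiv.Perm α}

theorem transport_mem {p q : α} (h : S p q) :
    transport S π q ∈ (cls S p).map π.toEmbedding := by
  rw [cls_eq h]
  exact sortMap_mem π (self_mem_cls S q)

theorem transport_lt {p q : α} (h : S p q) (hpq : p < q) : transport S π p < transport S π q := by
  change sortMap π (cls S p) p < sortMap π (cls S q) q
  rw [← cls_eq h]
  exact sortMap_lt π (self_mem_cls S p) (mem_cls.2 h) hpq

theorem map_transport_cls (p : α) :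
    (cls S p).map (transport S π).toEmbedding = (cls S p).map π.toEmbedding := by
  refine Finset.eq_of_subset_of_card_le ?_ (by simp)
  intro x hx
  obtain ⟨q, hq, rfl⟩ := Finset.mem_map.1 hx
  exact transport_mem (mem_cls.1 hq)

theorem cls_transport {S' : Setoid α}
    (hS : ∀ p q, S' (transport S π p) (transport S π q) ↔ S p q) (p : α) :
    cls S' (transport S π p) = (cls S p).map π.toEmbedding := by
  rw [← map_transport_cls]
  ext x
  obtain ⟨q, rfl⟩ := (transport S π).surjective x
  rw [mem_cls, hS]
  simp [mem_cls]

/-- The rearrangement of the rearranged partition along the inverse permutation undoes the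
rearrangement. -/
theorem transport_inv {S' : Setoid α}
    (hS : ∀ p q, S' (transport S π p) (transport S π q) ↔ S p q) (p : α) :
    transport S' π⁻¹ (transport S π p) = p := by
  refine eq_self_of_strictMonoOn (A := cls S p)
    (f := fun q => transport S' π⁻¹ (transport S π q)) ?_ ?_ (self_mem_cls S p)
  · intro q hq
    have h := transport_mem (S := S') (π := π⁻¹) ((hS p q).2 (mem_cls.1 hq))
    rw [cls_transport hS, Finset.map_map] at h
    obtain ⟨x, hx, hx'⟩ := Finset.mem_map.1 h
    have hx'' : x = transport S' π⁻¹ (transport S π q) := by simpa using hx'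
    exact hx'' ▸ hx
  · intro q hq r hr hqr
    have h : S q r := S.trans (S.symm (mem_cls.1 hq)) (mem_cls.1 hr)
    exact transport_lt ((hS q r).2 h) (transport_lt h hqr)

end Transport

/-! ### Exchanging the arrival times of clusters -/

/-- In the attachment structure `c`, the vertex `r` chooses the vertex `j` or one of its edges, and
both have arrived in the time window `W`. -/
def Points (W : Finset (Fin (N + 2))) (c : Slot N m → Choice N m) (r j : Fin (N + 2)) : Prop :=
  r ∈ W ∧ j ∈ W ∧ ∃ i, (c (r, i)).1 = j

/-- The partition of the vertices into clusters: the connected components inside the time window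
`W`. Vertices outside `W` are isolated. -/
def clusters (W : Finset (Fin (N + 2))) (c : Slot N m → Choice N m) : Setoid (Fin (N + 2)) :=
  Relation.EqvGen.setoid (Points W c)

/-- The permutation of the vertices which gives each cluster `C` the arrival times `π C` without
changing the order inside `C`. -/
noncomputable def arrival (W : Finset (Fin (N + 2))) (π : Equiv.Perm (Fin (N + 2)))
    (c : Slot N m → Choice N m) : Equiv.Perm (Fin (N + 2)) :=
  transport (clusters W c) π

/-- The attachment structure with rearranged arrival times. -/
noncomputable def relabel (W : Finset (Fin (N + 2))) (π : Equiv.Perm (Fin (N + 2)))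
    (c : Slot N m → Choice N m) : Slot N m → Choice N m := fun e =>
  (arrival W π c (c ((arrival W π c).symm e.1, e.2)).1, (c ((arrival W π c).symm e.1, e.2)).2)

section Relabel

variable {W : Finset (Fin (N + 2))} {π : Equiv.Perm (Fin (N + 2))} {c : Slot N m → Choice N m}

theorem relabel_arrival (r : Fin (N + 2)) (i : Fin m) :
    relabel W π c (arrival W π c r, i) = (arrival W π c (c (r, i)).1, (c (r, i)).2) := by
  simp [relabel]

theorem eq_or_mem_of_clusters {p q : Fin (N + 2)} (h : clusters W c p q) :
    p = q ∨ (p ∈ W ∧ q ∈ W) := by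
  induction h with
  | rel _ _ h => exact Or.inr ⟨h.1, h.2.1⟩
  | refl _ => exact Or.inl rfl
  | symm _ _ _ ih =>
    rcases ih with h | h
    · exact Or.inl h.symm
    · exact Or.inr h.symm
  | trans _ _ _ _ _ ih1 ih2 =>
    rcases ih1 with rfl | h1
    · exact ih2
    · rcases ih2 with rfl | h2
      · exact Or.inr h1
      · exact Or.inr ⟨h1.1, h2.2⟩

theorem arrival_of_notMem (hπ : ∀ p ∉ W, π p = p) {p : Fin (N + 2)} (hp : p ∉ W) :
    arrival W π c p = p := by
  have h := transport_mem (S := clusters W c) (π := π) (Setoid.refl' _ p)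
  obtain ⟨q, hq, hq'⟩ := Finset.mem_map.1 h
  rcases eq_or_mem_of_clusters (mem_cls.1 hq) with rfl | h
  · rw [arrival, ← hq']
    exact hπ p hp
  · exact absurd h.1 hp

theorem arrival_mem_iff (hπ : ∀ p ∉ W, π p = p) {p : Fin (N + 2)} :
    arrival W π c p ∈ W ↔ p ∈ W := by
  constructor
  · intro h
    by_contra hp
    rw [arrival_of_notMem hπ hp] at h
    exact hp h
  · intro hp
    by_contra h
    have := arrival_of_notMem (c := c) hπ h
    rw [(arrival W π c).injective this] at h
    exact h hp

theorem points_relabel (hπ : ∀ p ∉ W, π p = p) (r j : Fin (N + 2)) :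
    Points W (relabel W π c) (arrival W π c r) (arrival W π c j) ↔ Points W c r j := by
  simp only [Points, arrival_mem_iff hπ, relabel_arrival, (arrival W π c).injective.eq_iff]

theorem clusters_relabel (hπ : ∀ p ∉ W, π p = p) (p q : Fin (N + 2)) :
    clusters W (relabel W π c) (arrival W π c p) (arrival W π c q) ↔ clusters W c p q := by
  constructor
  · suffices h : ∀ x y, clusters W (relabel W π c) x y →
        clusters W c ((arrival W π c).symm x) ((arrival W π c).symm y) by
      intro h'
      simpa using h _ _ h'
    intro x y h
    induction h with
    | rel x y h =>
      refine Relation.EqvGen.rel _ _ ?_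
      rw [← points_relabel hπ]
      simpa using h
    | refl x => exact Setoid.refl' _ _
    | symm _ _ _ ih => exact Setoid.symm' _ ih
    | trans _ _ _ _ _ ih1 ih2 => exact Setoid.trans' _ ih1 ih2
  · intro h
    induction h with
    | rel x y h => exact Relation.EqvGen.rel _ _ ((points_relabel hπ x y).2 h)
    | refl x => exact Setoid.refl' _ _
    | symm _ _ _ ih => exact Setoid.symm' _ ih
    | trans _ _ _ _ _ ih1 ih2 => exact Setoid.trans' _ ih1 ih2

theorem arrival_inv (hπ : ∀ p ∉ W, π p = p) (p : Fin (N + 2)) :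
    arrival W π⁻¹ (relabel W π c) (arrival W π c p) = p :=
  transport_inv (clusters_relabel hπ) p

theorem relabel_inv (hπ : ∀ p ∉ W, π p = p) : relabel W π⁻¹ (relabel W π c) = c := by
  funext e
  have h : (arrival W π⁻¹ (relabel W π c)).symm e.1 = arrival W π c e.1 := by
    rw [Equiv.symm_apply_eq, arrival_inv hπ]
  rw [relabel, h, relabel_arrival, arrival_inv hπ]

theorem inv_fix (hπ : ∀ p ∉ W, π p = p) : ∀ p ∉ W, π⁻¹ p = p := by
  intro p hp
  rw [Equiv.Perm.inv_eq_iff_eq, hπ p hp]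

/-- Rearranging the arrival times is a bijection of the attachment structures. -/
noncomputable def relabelEquiv (m : ℕ) (hπ : ∀ p ∉ W, π p = p) :
    (Slot N m → Choice N m) ≃ (Slot N m → Choice N m) where
  toFun := relabel W π
  invFun := relabel W π⁻¹
  left_inv _ := relabel_inv hπ
  right_inv c := by
    have := relabel_inv (c := c) (inv_fix hπ)
    rwa [inv_inv] at this

theorem resolve_relabel (f : ℕ) (r : Fin (N + 2)) (i : Fin m) :
    resolve (relabel W π c) f (arrival W π c r, i) = arrival W π c (resolve c f (r, i)) := by
  induction f generalizing r i with
  | zero => rfl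
  | succ f ih =>
    simp only [resolve, relabel_arrival]
    rcases (c (r, i)).2 with _ | i'
    · rfl
    · exact ih _ _

end Relabel

section Window

variable {s T : Fin (N + 2)} {π : Equiv.Perm (Fin (N + 2))} {c : Slot N m → Choice N m}

theorem two_le_arrival_iff (hs : 2 ≤ s.val) (hπ : ∀ p ∉ Finset.Icc s T, π p = p)
    (p : Fin (N + 2)) : 2 ≤ (arrival (Finset.Icc s T) π c p).val ↔ 2 ≤ p.val := by
  by_cases hp : p ∈ Finset.Icc s T
  · have h := (arrival_mem_iff (c := c) hπ).2 hp
    rw [Finset.mem_Icc, Fin.le_def] at h hp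
    exact ⟨fun _ => hs.trans hp.1, fun _ => hs.trans h.1⟩
  · rw [arrival_of_notMem hπ hp]

/-- The endpoints of the edges, read through the labels, do not depend on the arrival times of the
clusters. -/
theorem snapshot_relabel {V : Type*} [DecidableEq V] (hs : 2 ≤ s.val)
    (hπ : ∀ p ∉ Finset.Icc s T, π p = p) (l : Fin (N + 2) ≃ V) :
    snapshot ((arrival (Finset.Icc s T) π c).symm.trans l) (relabel (Finset.Icc s T) π c) (N + 2) =
      snapshot l c (N + 2) := by
  set σ := arrival (Finset.Icc s T) π c with hσ
  have hfix : ∀ p : Fin (N + 2), p.val < 2 → σ.symm p = p := by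
    intro p hp
    rw [Equiv.symm_apply_eq]
    refine (arrival_of_notMem hπ ?_).symm
    rw [Finset.mem_Icc, Fin.le_def]
    omega
  have h1 : vertsBelow (σ.symm.trans l) (N + 2) = vertsBelow l (N + 2) := by
    ext v
    obtain ⟨p, rfl⟩ := l.surjective v
    have : l p = (σ.symm.trans l) (σ p) := by simp
    rw [mem_vertsBelow]
    conv_lhs => rw [this]
    rw [mem_vertsBelow]
    simp
  have h2 : slotsBelow N m ((N + 2) * m) = (slotsBelow N m ((N + 2) * m)).map
      (σ.prodCongr (Equiv.refl _)).toEmbedding := by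
    ext ⟨r, i⟩
    obtain ⟨r, rfl⟩ := σ.surjective r
    simp only [slotsBelow, Finset.mem_filter, Finset.mem_univ, true_and, rank_lt, and_true,
      Finset.mem_map, Equiv.coe_toEmbedding, Equiv.prodCongr_apply, Prod.exists, Prod.map,
      Equiv.refl_apply, Prod.mk.injEq, σ.injective.eq_iff]
    rw [two_le_arrival_iff hs hπ]
    constructor
    · intro h; exact ⟨r, i, h, rfl, rfl⟩
    · rintro ⟨_, _, h, rfl, rfl⟩; exact h
  unfold snapshot
  congr 1
  unfold edgesBelow
  congr 1
  · simp only [Equiv.trans_apply]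
    rw [hfix 0 (by simp), hfix 1 (by simp)]
  · conv_lhs => rw [h2, Finset.map_val, Multiset.map_map]
    refine Multiset.map_congr rfl fun e _ => ?_
    have := resolve_relabel (W := Finset.Icc s T) (π := π) (c := c) ((N + 2) * m) e.1 e.2
    simp only [Function.comp_apply, Equiv.coe_toEmbedding, Equiv.prodCongr_apply, Prod.map,
      Equiv.refl_apply, Equiv.trans_apply, Equiv.symm_apply_apply, endpoint]
    rw [← hσ] at this
    rw [this, Equiv.symm_apply_apply]

theorem admissible_relabel (hs : 2 ≤ s.val) (hπ : ∀ p ∉ Finset.Icc s T, π p = p)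
    (hc : ∀ e, Admissible e (c e)) (e : Slot N m) :
    Admissible e (relabel (Finset.Icc s T) π c e) := by
  obtain ⟨r, i⟩ := e
  obtain ⟨r, rfl⟩ := (arrival (Finset.Icc s T) π c).surjective r
  rw [relabel_arrival]
  have hlt : (c (r, i)).1 < r →
      arrival (Finset.Icc s T) π c (c (r, i)).1 < arrival (Finset.Icc s T) π c r := by
    intro h
    by_cases hr : r ∈ Finset.Icc s T <;> by_cases hj : (c (r, i)).1 ∈ Finset.Icc s T
    · exact transport_lt (Setoid.symm' _ (Relation.EqvGen.rel _ _ ⟨hr, hj, i, rfl⟩)) h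
    · have := (arrival_mem_iff (c := c) hπ).2 hr
      rw [arrival_of_notMem hπ hj]
      rw [Finset.mem_Icc] at hr this hj
      refine lt_of_lt_of_le (not_le.1 fun h' => hj ⟨h', h.le.trans hr.2⟩) this.1
    · have := (arrival_mem_iff (c := c) hπ).2 hj
      rw [arrival_of_notMem hπ hr]
      rw [Finset.mem_Icc] at hr this hj
      refine lt_of_le_of_lt this.2 (not_le.1 fun h' => hr ⟨hj.1.trans h.le, h'⟩)
    · rwa [arrival_of_notMem hπ hr, arrival_of_notMem hπ hj]
  rcases hc (r, i) with ⟨h, h'⟩ | ⟨h, ⟨h1, h2⟩ | ⟨i', h1, h2, h3⟩⟩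
  · left
    refine ⟨not_le.1 fun h2 => h.not_ge ((two_le_arrival_iff hs hπ r).1 h2), ?_⟩
    rw [h']
  · exact Or.inr ⟨(two_le_arrival_iff hs hπ r).2 h, Or.inl ⟨h1, hlt h2⟩⟩
  · refine Or.inr ⟨(two_le_arrival_iff hs hπ r).2 h, Or.inr ⟨i', h1,
      (two_le_arrival_iff hs hπ _).2 h2, ?_⟩⟩
    rcases h3 with h3 | ⟨h3, h4⟩
    · exact Or.inl (hlt h3)
    · exact Or.inr ⟨congrArg (arrival (Finset.Icc s T) π c) h3, h4⟩

/-- The probability of an attachment structure. -/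
noncomputable def mass (a : Fin (N + 2) → ℝ) (c : Slot N m → Choice N m) : ℝ :=
  ∏ e, prob a e (c e)

theorem mass_relabel (hs : 2 ≤ s.val) (hπ : ∀ p ∉ Finset.Icc s T, π p = p)
    {a : Fin (N + 2) → ℝ} (ha : ∀ r ∈ Finset.Icc s T, a r = a T) :
    mass a (relabel (Finset.Icc s T) π c) = mass a c := by
  by_cases hc : ∀ e, Admissible e (c e)
  · unfold mass prob
    rw [Finset.prod_div_distrib, Finset.prod_div_distrib]
    congr 1
    rw [← ((arrival (Finset.Icc s T) π c).prodCongr (Equiv.refl (Fin m))).prod_comp]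
    refine Finset.prod_congr rfl fun e _ => ?_
    have h := admissible_relabel hs hπ hc (arrival (Finset.Icc s T) π c e.1, e.2)
    simp only [Equiv.prodCongr_apply, Prod.map, Equiv.refl_apply]
    rw [weight, if_pos h, weight, if_pos (hc e), relabel_arrival]
    have : a (arrival (Finset.Icc s T) π c e.1) = a e.1 := by
      by_cases he : e.1 ∈ Finset.Icc s T
      · rw [ha _ ((arrival_mem_iff hπ).2 he), ha _ he]
      · rw [arrival_of_notMem hπ he]
    simp only [this]
  · have h0 : ∀ c' : Slot N m → Choice N m, (¬ ∀ e, Admissible e (c' e)) → mass a c' = 0 := by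
      intro c' hc'
      push Not at hc'
      obtain ⟨e, he⟩ := hc'
      refine Finset.prod_eq_zero (Finset.mem_univ e) ?_
      by_contra h
      exact he (admissible_of_prob_ne_zero h)
    rw [h0 c hc, h0]
    intro h
    have := admissible_relabel hs (inv_fix hπ) h
    rw [relabel_inv hπ] at this
    exact hc this

/-- The law of the attachment structure is invariant under exchanges of the arrival times of
clusters in a window in which all vertices attach with the same parameter. -/
theorem sum_mass_relabel (hs : 2 ≤ s.val) (hπ : ∀ p ∉ Finset.Icc s T, π p = p)
    {a : Fin (N + 2) → ℝ} (ha : ∀ r ∈ Finset.Icc s T, a r = a T)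
    (F : (Slot N m → Choice N m) → ℝ) :
    ∑ c, mass a c * F (relabel (Finset.Icc s T) π c) = ∑ c, mass a c * F c := by
  rw [← (relabelEquiv m hπ).sum_comp fun c => mass a c * F c]
  refine Finset.sum_congr rfl fun c _ => ?_
  change _ = mass a (relabel (Finset.Icc s T) π c) *
    F (relabel (Finset.Icc s T) π c)
  rw [mass_relabel hs hπ ha]

end Window

/-! ### The expected size of a cluster -/

section PathCount

variable {α : Type*} [DecidableEq α]

open Classical in
/-- The number of nonempty simple paths in `L` which start at `v`, have at most `n` steps and visit
only vertices of `U` after `v`. -/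
noncomputable def pathCount (L : α → α → Prop) : ℕ → α → Finset α → ℝ
  | 0, _, _ => 0
  | n + 1, v, U => ∑ u ∈ U, if L v u then 1 + pathCount L n u (U.erase u) else 0

theorem pathCount_nonneg (L : α → α → Prop) (n : ℕ) (v : α) (U : Finset α) :
    0 ≤ pathCount L n v U := by
  induction n generalizing v U with
  | zero => exact le_rfl
  | succ n ih =>
    refine Finset.sum_nonneg fun u _ => ?_
    split_ifs
    · linarith [ih u (U.erase u)]
    · exact le_rfl

theorem pathCount_mono {L L' : α → α → Prop} (n : ℕ) (v : α) (U : Finset α)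
    (h : ∀ x ∈ insert v U, ∀ y ∈ U, L x y → L' x y) : pathCount L n v U ≤ pathCount L' n v U := by
  induction n generalizing v U with
  | zero => exact le_rfl
  | succ n ih =>
    refine Finset.sum_le_sum fun u hu => ?_
    have h1 : pathCount L n u (U.erase u) ≤ pathCount L' n u (U.erase u) := by
      refine ih u _ fun x hx y hy => h x ?_ y (Finset.mem_of_mem_erase hy)
      rw [Finset.insert_erase hu] at hx
      exact Finset.mem_insert_of_mem hx
    have h2 := pathCount_nonneg L' n u (U.erase u)
    by_cases h3 : L v u
    · rw [if_pos h3, if_pos (h v (Finset.mem_insert_self _ _) u hu h3)]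
      linarith
    · rw [if_neg h3]
      split_ifs
      · linarith
      · exact le_rfl

/-- Loops at the starting point of a path can be erased. -/
theorem reflTransGen_erase {L : α → α → Prop} {U : Finset α} {v p : α}
    (h : Relation.ReflTransGen (fun x y => L x y ∧ y ∈ U) v p) :
    Relation.ReflTransGen (fun x y => L x y ∧ y ∈ U.erase v) v p := by
  induction h with
  | refl => exact Relation.ReflTransGen.refl
  | tail _ hpq ih =>
    rename_i p q _
    by_cases hq : q = v
    · rw [hq]
    · exact ih.tail ⟨hpq.1, Finset.mem_erase.2 ⟨hq, hpq.2⟩⟩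

open Classical in
theorem card_reachable_le_pathCount [Fintype α] (L : α → α → Prop) (n : ℕ) (v : α) (U : Finset α)
    (hn : U.card ≤ n) :
    ((Finset.univ.filter fun p => p ≠ v ∧
      Relation.ReflTransGen (fun x y => L x y ∧ y ∈ U) v p).card : ℝ) ≤ pathCount L n v U := by
  induction n generalizing v U with
  | zero =>
    have hU : U = ∅ := Finset.card_eq_zero.1 (by omega)
    rw [Finset.card_eq_zero.2]
    · simp [pathCount]
    · refine Finset.filter_eq_empty_iff.2 fun p _ hp => hp.1 ?_
      rcases hp.2.cases_tail with h | ⟨q, _, h⟩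
      · exact h
      · simp [hU] at h
  | succ n ih =>
    have hsub : (Finset.univ.filter fun p => p ≠ v ∧
        Relation.ReflTransGen (fun x y => L x y ∧ y ∈ U) v p) ⊆
        (U.filter (L v)).biUnion fun u => insert u (Finset.univ.filter fun p => p ≠ u ∧
          Relation.ReflTransGen (fun x y => L x y ∧ y ∈ U.erase u) u p) := by
      intro p hp
      obtain ⟨hpv, hp⟩ := (Finset.mem_filter.1 hp).2
      rcases hp.cases_head with h | ⟨u, ⟨hvu, hu⟩, hup⟩
      · exact absurd h.symm hpv
      · rw [Finset.mem_biUnion]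
        refine ⟨u, Finset.mem_filter.2 ⟨hu, hvu⟩, ?_⟩
        by_cases h : p = u
        · exact h ▸ Finset.mem_insert_self _ _
        · exact Finset.mem_insert_of_mem
            (Finset.mem_filter.2 ⟨Finset.mem_univ _, h, reflTransGen_erase hup⟩)
    have h1 := (Finset.card_le_card hsub).trans Finset.card_biUnion_le
    refine le_trans (Nat.cast_le.2 h1) ?_
    rw [Nat.cast_sum, Finset.sum_filter, pathCount]
    refine Finset.sum_le_sum fun u hu => ?_
    split_ifs
    · have h2 := ih u (U.erase u) (by rw [Finset.card_erase_of_mem hu]; omega)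
      have h3 : ((insert u (Finset.univ.filter fun p => p ≠ u ∧
          Relation.ReflTransGen (fun x y => L x y ∧ y ∈ U.erase u) u p)).card : ℝ) ≤
          (Finset.univ.filter fun p => p ≠ u ∧
          Relation.ReflTransGen (fun x y => L x y ∧ y ∈ U.erase u) u p).card + 1 := by
        exact_mod_cast Finset.card_insert_le _ _
      linarith
    · exact le_rfl

end PathCount

/-- Two different vertices one of which chooses the other one or one of its edges. -/
def Linked (c : Slot N m → Choice N m) (x y : Fin (N + 2)) : Prop :=
  x ≠ y ∧ ((∃ i, (c (x, i)).1 = y) ∨ ∃ i, (c (y, i)).1 = x)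

theorem Linked.symm {c : Slot N m → Choice N m} {x y : Fin (N + 2)} (h : Linked c x y) :
    Linked c y x := ⟨h.1.symm, h.2.symm⟩

theorem reflTransGen_of_clusters {W : Finset (Fin (N + 2))} {c : Slot N m → Choice N m}
    {v p : Fin (N + 2)} (h : clusters W c v p) :
    Relation.ReflTransGen (fun x y => Linked c x y ∧ y ∈ W.erase v) v p := by
  have h1 : Relation.ReflTransGen (fun x y => Linked c x y ∧ x ∈ W ∧ y ∈ W) v p := by
    induction h with
    | rel x y h =>
      by_cases hxy : x = y
      · rw [hxy]
      · exact Relation.ReflTransGen.single ⟨⟨hxy, Or.inl h.2.2⟩, h.1, h.2.1⟩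
    | refl x => exact Relation.ReflTransGen.refl
    | symm x y _ ih =>
      have : Std.Symm fun x y => Linked c x y ∧ x ∈ W ∧ y ∈ W :=
        ⟨fun x y h => ⟨h.1.symm, h.2.2, h.2.1⟩⟩
      exact Relation.ReflTransGen.stdSymm.symm _ _ ih
    | trans _ _ _ _ _ ih1 ih2 => exact ih1.trans ih2
  exact reflTransGen_erase (Relation.ReflTransGen.mono (fun _ _ h => ⟨h.1, h.2.2⟩) _ _ h1)

section Mass

variable {a : Fin (N + 2) → ℝ}

theorem mass_nonneg (ha : ∀ r, 0 < a r) (c : Slot N m → Choice N m) : 0 ≤ mass a c :=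
  Finset.prod_nonneg fun e _ => prob_nonneg ha e _

theorem sum_mass (m : ℕ) (ha : ∀ r, 0 < a r) : ∑ c : Slot N m → Choice N m, mass a c = 1 := by
  unfold mass
  rw [← Fintype.piFinset_univ, ← Finset.prod_univ_sum]
  exact Finset.prod_eq_one fun e _ => sum_prob ha e

/-- Independence of the choice at the slot `e` from the other choices. -/
theorem sum_mass_mul_slot (ha : ∀ r, 0 < a r) (e : Slot N m) (g : Choice N m → ℝ)
    (G : (Slot N m → Choice N m) → ℝ) (hG : ∀ c k, G (Function.update c e k) = G c) :
    ∑ c, mass a c * (g (c e) * G c) = (∑ k, prob a e k * g k) * ∑ c, mass a c * G c := by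
  have h := sum_prod_resample (prob a) e (sum_prob ha e) fun c => g (c e) * G c
  change _ = ∑ c, mass a c * (g (c e) * G c) at h
  rw [← h, Finset.mul_sum]
  refine Finset.sum_congr rfl fun c _ => ?_
  simp only [Function.update_self, hG, ← mul_assoc]
  rw [← Finset.sum_mul]
  change mass a c * _ = _
  ring

theorem linked_of_linked_update {c : Slot N m → Choice N m} {e : Slot N m} {x y : Fin (N + 2)}
    (h : Linked (Function.update c e (e.1, none)) x y) : Linked c x y := by
  have key : ∀ x y : Fin (N + 2), x ≠ y → ∀ i, (Function.update c e (e.1, none) (x, i)).1 = y →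
      (c (x, i)).1 = y := by
    intro x y hxy i hi
    by_cases he : (x, i) = e
    · subst he
      simp only [Function.update_self] at hi
      exact absurd hi hxy
    · rwa [Function.update_of_ne he] at hi
  refine ⟨h.1, ?_⟩
  rcases h.2 with ⟨i, hi⟩ | ⟨i, hi⟩
  · exact Or.inl ⟨i, key x y h.1 i hi⟩
  · exact Or.inr ⟨i, key y x h.1.symm i hi⟩

open Classical in
/-- If the slot `e` links two vertices which are not both in `U`, then this slot is irrelevant for
the paths inside `U`, and it links the two vertices with probability at most `q` given the other
slots. -/
theorem sum_mass_link_mul_pathCount_le (ha : ∀ r, 0 < a r) {q : ℝ} {e : Slot N m} {w : Fin (N + 2)}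
    (hq : ∑ k, prob a e k * (if k.1 = w then 1 else 0) ≤ q) (n : ℕ) {u : Fin (N + 2)}
    {U : Finset (Fin (N + 2))} (hu : u ∈ U) (hU : e.1 ∉ U ∨ w ∉ U) :
    ∑ c, mass a c * ((if (c e).1 = w then 1 else 0) *
        (1 + pathCount (Linked c) n u (U.erase u))) ≤
      q * (1 + ∑ c : Slot N m → Choice N m, mass a c * pathCount (Linked c) n u (U.erase u)) := by
  -- Making the slot `e` idle makes the paths inside `U` independent of it without losing any.
  set off : (Slot N m → Choice N m) → Slot N m → Choice N m := fun c =>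
    Function.update c e (e.1, none) with hoff
  have h1 : ∀ c : Slot N m → Choice N m, (if (c e).1 = w then (1 : ℝ) else 0) *
      (1 + pathCount (Linked c) n u (U.erase u)) ≤ (if (c e).1 = w then 1 else 0) *
      (1 + pathCount (Linked (off c)) n u (U.erase u)) := by
    intro c
    split_ifs with hw
    · rw [one_mul, one_mul]
      refine add_le_add le_rfl (pathCount_mono _ _ _ fun x hx y hy h => ?_)
      rw [Finset.insert_erase hu] at hx
      have hy := Finset.mem_of_mem_erase hy
      have key : ∀ x ∈ U, ∀ y ∈ U, ∀ i, (c (x, i)).1 = y → (off c (x, i)).1 = y := by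
        intro x hx y hy i hi
        have : (x, i) ≠ e := by
          rintro rfl
          rcases hU with h | h
          · exact h hx
          · rw [← hw, hi] at h
            exact h hy
        rw [hoff]
        simp only
        rwa [Function.update_of_ne this]
      refine ⟨h.1, ?_⟩
      rcases h.2 with ⟨i, hi⟩ | ⟨i, hi⟩
      · exact Or.inl ⟨i, key x hx y hy i hi⟩
      · exact Or.inr ⟨i, key y hy x hx i hi⟩
    · simp
  have hind : ∀ c k, 1 + pathCount (Linked (off (Function.update c e k))) n u (U.erase u) =
      1 + pathCount (Linked (off c)) n u (U.erase u) := by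
    intro c k
    simp [hoff]
  have h2 := sum_mass_mul_slot ha e (fun k => if k.1 = w then (1 : ℝ) else 0)
    (fun c => 1 + pathCount (Linked (off c)) n u (U.erase u)) hind
  have h3 : ∑ c, mass a c * (1 + pathCount (Linked (off c)) n u (U.erase u)) ≤
      1 + ∑ c : Slot N m → Choice N m, mass a c * pathCount (Linked c) n u (U.erase u) := by
    simp_rw [mul_add, mul_one]
    rw [Finset.sum_add_distrib, sum_mass m ha]
    refine add_le_add le_rfl ?_
    refine Finset.sum_le_sum fun c _ => ?_
    exact mul_le_mul_of_nonneg_left (pathCount_mono (L := Linked (off c)) (L' := Linked c) n u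
      (U.erase u) fun x _ y _ h => linked_of_linked_update h) (mass_nonneg ha c)
  have h0 : 0 ≤ ∑ k, prob a e k * (if k.1 = w then (1 : ℝ) else 0) :=
    Finset.sum_nonneg fun k _ => mul_nonneg (prob_nonneg ha e k) (by split_ifs <;> norm_num)
  have h4 : 0 ≤ 1 + ∑ c : Slot N m → Choice N m, mass a c * pathCount (Linked c) n u (U.erase u) :=
    add_nonneg zero_le_one (Finset.sum_nonneg fun c _ =>
      mul_nonneg (mass_nonneg ha c) (pathCount_nonneg _ _ _ _))
  calc _ ≤ ∑ c, mass a c * ((if (c e).1 = w then 1 else 0) *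
        (1 + pathCount (Linked (off c)) n u (U.erase u))) :=
        Finset.sum_le_sum fun c _ => mul_le_mul_of_nonneg_left (h1 c) (mass_nonneg ha c)
    _ = _ := h2
    _ ≤ _ := mul_le_mul_of_nonneg_left h3 h0
    _ ≤ _ := mul_le_mul_of_nonneg_right hq h4

open Classical in
/-- In a window of at most `1 / (4 m q)` vertices, where `q` bounds the probability that a given
slot points to a given vertex, the expected number of simple paths from a vertex is at most `1`. -/
theorem sum_mass_pathCount_le (ha : ∀ r, 0 < a r) {q : ℝ} {W : Finset (Fin (N + 2))}
    (hq : ∀ e : Slot N m, e.1 ∈ W → ∀ w ∈ W, w ≠ e.1 →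
      ∑ k, prob a e k * (if k.1 = w then 1 else 0) ≤ q)
    (hW : (W.card : ℝ) * (m * q) ≤ 1 / 4) (n : ℕ) (v : Fin (N + 2)) (U : Finset (Fin (N + 2)))
    (hv : v ∈ W) (hU : U ⊆ W) (hvU : v ∉ U) :
    ∑ c : Slot N m → Choice N m, mass a c * pathCount (Linked c) n v U ≤ 1 := by
  induction n generalizing v U with
  | zero => simp [pathCount]
  | succ n ih =>
    have hbound : ∀ u ∈ U, ∑ c : Slot N m → Choice N m, mass a c *
        (if Linked c v u then 1 + pathCount (Linked c) n u (U.erase u) else 0) ≤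
        m * (2 * (q * 2)) := by
      intro u hu
      have hne : v ≠ u := fun h => hvU (h ▸ hu)
      -- The link between `v` and `u` is one of the `2 m` slots of these two vertices.
      have hpt : ∀ c : Slot N m → Choice N m,
          (if Linked c v u then 1 + pathCount (Linked c) n u (U.erase u) else 0) ≤
          ∑ i : Fin m, ((if (c (v, i)).1 = u then 1 else 0) *
              (1 + pathCount (Linked c) n u (U.erase u)) +
            (if (c (u, i)).1 = v then 1 else 0) *
              (1 + pathCount (Linked c) n u (U.erase u))) := by
        intro c
        have h0 : 0 ≤ 1 + pathCount (Linked c) n u (U.erase u) :=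
          add_nonneg zero_le_one (pathCount_nonneg _ _ _ _)
        have h1 : ∀ i : Fin m, 0 ≤ (if (c (v, i)).1 = u then 1 else 0) *
            (1 + pathCount (Linked c) n u (U.erase u)) := fun i =>
          mul_nonneg (by split_ifs <;> norm_num) h0
        have h2 : ∀ i : Fin m, 0 ≤ (if (c (u, i)).1 = v then 1 else 0) *
            (1 + pathCount (Linked c) n u (U.erase u)) := fun i =>
          mul_nonneg (by split_ifs <;> norm_num) h0
        split_ifs with hL
        · obtain ⟨i, hi⟩ : ∃ i, (c (v, i)).1 = u ∨ (c (u, i)).1 = v := by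
            rcases hL.2 with ⟨i, hi⟩ | ⟨i, hi⟩
            · exact ⟨i, Or.inl hi⟩
            · exact ⟨i, Or.inr hi⟩
          refine le_trans ?_ (Finset.single_le_sum
            (fun i _ => add_nonneg (h1 i) (h2 i)) (Finset.mem_univ i))
          rcases hi with hi | hi
          · have := h2 i
            rw [if_pos hi]
            linarith
          · have := h1 i
            rw [if_pos hi]
            linarith
        · exact Finset.sum_nonneg fun i _ => add_nonneg (h1 i) (h2 i)
      have hih := ih u (U.erase u) (hU hu) ((Finset.erase_subset _ _).trans hU)
        (Finset.notMem_erase _ _)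
      rcases Nat.eq_zero_or_pos m with hm | hm
      · subst hm
        refine (Finset.sum_le_sum fun c _ =>
          mul_le_mul_of_nonneg_left (hpt c) (mass_nonneg ha c)).trans ?_
        simp
      have hq0 : 0 ≤ q := le_trans (Finset.sum_nonneg fun k _ =>
        mul_nonneg (prob_nonneg ha _ k) (by split_ifs <;> norm_num))
        (hq (v, ⟨0, hm⟩) hv u (hU hu) hne.symm)
      have hslot : ∀ e : Slot N m, ∀ w, e.1 ∈ W → w ∈ W → w ≠ e.1 → (e.1 ∉ U ∨ w ∉ U) →
          ∑ c, mass a c * ((if (c e).1 = w then 1 else 0) *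
            (1 + pathCount (Linked c) n u (U.erase u))) ≤ q * 2 := by
        intro e w he hw hwe hdis
        refine (sum_mass_link_mul_pathCount_le ha (hq e he w hw hwe) n hu hdis).trans ?_
        exact mul_le_mul_of_nonneg_left (by linarith) hq0
      calc _ ≤ ∑ c : Slot N m → Choice N m, mass a c *
            ∑ i : Fin m, ((if (c (v, i)).1 = u then 1 else 0) *
              (1 + pathCount (Linked c) n u (U.erase u)) +
            (if (c (u, i)).1 = v then 1 else 0) *
              (1 + pathCount (Linked c) n u (U.erase u))) :=
            Finset.sum_le_sum fun c _ => mul_le_mul_of_nonneg_left (hpt c) (mass_nonneg ha c)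
        _ = ∑ i : Fin m, (∑ c : Slot N m → Choice N m, mass a c *
              ((if (c (v, i)).1 = u then 1 else 0) *
              (1 + pathCount (Linked c) n u (U.erase u))) +
            ∑ c : Slot N m → Choice N m, mass a c * ((if (c (u, i)).1 = v then 1 else 0) *
              (1 + pathCount (Linked c) n u (U.erase u)))) := by
            simp_rw [← Finset.sum_add_distrib, Finset.mul_sum]
            rw [Finset.sum_comm]
            simp_rw [mul_add]
        _ ≤ ∑ _i : Fin m, (2 * (q * 2)) := by
            refine Finset.sum_le_sum fun i _ => ?_
            have h1 := hslot (v, i) u hv (hU hu) hne.symm (Or.inl hvU)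
            have h2 := hslot (u, i) v (hU hu) hv hne (Or.inr hvU)
            linarith
        _ = _ := by simp
    calc ∑ c : Slot N m → Choice N m, mass a c * pathCount (Linked c) (n + 1) v U
        = ∑ u ∈ U, ∑ c : Slot N m → Choice N m, mass a c *
          (if Linked c v u then 1 + pathCount (Linked c) n u (U.erase u) else 0) := by
          simp_rw [pathCount, Finset.mul_sum]
          rw [Finset.sum_comm]
      _ ≤ ∑ u ∈ U, (m * (2 * (q * 2)) : ℝ) := Finset.sum_le_sum hbound
      _ = U.card * (m * q) * 4 := by rw [Finset.sum_const, nsmul_eq_mul]; ring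
      _ ≤ 1 := by
          rcases U.eq_empty_or_nonempty with rfl | ⟨u, hu⟩
          · simp
          rcases Nat.eq_zero_or_pos m with hm | hm
          · subst hm; simp
          have hq0 : 0 ≤ q := le_trans (Finset.sum_nonneg fun k _ =>
            mul_nonneg (prob_nonneg ha _ k) (by split_ifs <;> norm_num))
            (hq (v, ⟨0, hm⟩) hv u (hU hu) (fun h => hvU (by rwa [h] at hu)))
          have h1 : (U.card : ℝ) ≤ W.card := by exact_mod_cast Finset.card_le_card hU
          have h2 : (U.card : ℝ) * (m * q) ≤ W.card * (m * q) :=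
            mul_le_mul_of_nonneg_right h1 (by positivity)
          linarith

open Classical in
/-- In a short window the cluster of a vertex has, in expectation, at most one further vertex. -/
theorem sum_mass_card_cluster_le (ha : ∀ r, 0 < a r) {q : ℝ} {W : Finset (Fin (N + 2))}
    (hq : ∀ e : Slot N m, e.1 ∈ W → ∀ w ∈ W, w ≠ e.1 →
      ∑ k, prob a e k * (if k.1 = w then 1 else 0) ≤ q)
    (hW : (W.card : ℝ) * (m * q) ≤ 1 / 4) (v : Fin (N + 2)) (hv : v ∈ W) :
    ∑ c : Slot N m → Choice N m, mass a c *
      ((Finset.univ.filter fun p => p ≠ v ∧ clusters W c v p).card : ℝ) ≤ 1 := by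
  refine le_trans (Finset.sum_le_sum fun c _ => mul_le_mul_of_nonneg_left ?_ (mass_nonneg ha c))
    (sum_mass_pathCount_le ha hq hW W.card v (W.erase v) hv (Finset.erase_subset _ _)
      (Finset.notMem_erase _ _))
  refine le_trans ?_ (card_reachable_le_pathCount _ _ _ _ (Finset.card_erase_le))
  refine Nat.cast_le.2 (Finset.card_le_card fun p hp => ?_)
  simp only [Finset.mem_filter, Finset.mem_univ, true_and] at hp ⊢
  exact ⟨hp.1, reflTransGen_of_clusters hp.2⟩

end Mass

/-! ### Averaging over the arrival times of the clusters -/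

/-- The vertex of the cluster of `p` that arrives last. -/
noncomputable def lastOf (W : Finset (Fin (N + 2))) (c : Slot N m → Choice N m)
    (p : Fin (N + 2)) : Fin (N + 2) :=
  (cls (clusters W c) p).max' ⟨p, self_mem_cls _ p⟩

/-- For each choice of the vertex `r`, whether it copies an edge, and then the index of that edge
among those sent by its vertex. -/
def row (c : Slot N m → Choice N m) (r : Fin (N + 2)) : Fin m → Option (Fin m) :=
  fun i => (c (r, i)).2

section Last

variable {W : Finset (Fin (N + 2))} {π : Equiv.Perm (Fin (N + 2))} {c : Slot N m → Choice N m}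

theorem lastOf_relabel (hπ : ∀ p ∉ W, π p = p) (p : Fin (N + 2)) :
    lastOf W (relabel W π c) (π p) = arrival W π c (lastOf W c p) := by
  have h1 : cls (clusters W (relabel W π c)) (arrival W π c p) =
      (cls (clusters W c) p).map π.toEmbedding := cls_transport (clusters_relabel hπ) p
  have h2 : cls (clusters W (relabel W π c)) (π p) =
      (cls (clusters W c) p).map (arrival W π c).toEmbedding := by
    have hmem : π p ∈ cls (clusters W (relabel W π c)) (arrival W π c p) := by
      rw [h1]
      exact Finset.mem_map_of_mem _ (self_mem_cls _ p)
    rw [← cls_eq (mem_cls.1 hmem), h1]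
    exact (map_transport_cls p).symm
  have h3 := Finset.max'_mem (cls (clusters W c) p) ⟨p, self_mem_cls _ p⟩
  refine le_antisymm (Finset.max'_le _ _ _ fun x hx => ?_) (Finset.le_max' _ _ ?_)
  · rw [h2] at hx
    obtain ⟨y, hy, rfl⟩ := Finset.mem_map.1 hx
    rcases (Finset.le_max' _ y hy).eq_or_lt with h | h
    · exact (congrArg (arrival W π c) h).le
    · exact (transport_lt (Setoid.trans' _ (Setoid.symm' _ (mem_cls.1 hy)) (mem_cls.1 h3)) h).le
  · rw [h2]
    exact Finset.mem_map_of_mem _ h3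

theorem row_lastOf_relabel (hπ : ∀ p ∉ W, π p = p) (p : Fin (N + 2)) :
    row (relabel W π c) (lastOf W (relabel W π c) (π p)) = row c (lastOf W c p) := by
  rw [lastOf_relabel hπ]
  funext i
  simp only [row, relabel_arrival]

theorem lastOf_top {s T : Fin (N + 2)} : lastOf (Finset.Icc s T) c T = T := by
  refine le_antisymm (Finset.max'_le _ _ _ fun q hq => ?_)
    (Finset.le_max' _ _ (self_mem_cls _ T))
  rcases eq_or_mem_of_clusters (mem_cls.1 hq) with h | h
  · exact h.ge
  · exact (Finset.mem_Icc.1 h.2).2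

/-- The attachment structure in which the vertex `T` sends its edges nowhere. -/
def detach (T : Fin (N + 2)) (c : Slot N m → Choice N m) : Slot N m → Choice N m :=
  fun e => if e.1 = T then (T, none) else c e

/-- Detaching `T` does not affect the clusters not containing `T`. -/
theorem row_lastOf_detach {T p : Fin (N + 2)} (hp : ¬ clusters W c T p) :
    row (detach T c) (lastOf W (detach T c) p) = row c (lastOf W c p) := by
  have hsub : ∀ x y, clusters W (detach T c) x y → clusters W c x y := by
    intro x y h
    induction h with
    | rel x y h =>
      obtain ⟨hx, hy, i, hi⟩ := h
      by_cases hxT : x = T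
      · simp only [detach, hxT, if_true] at hi
        rw [hxT, hi]
      · simp only [detach, hxT, if_false] at hi
        exact Relation.EqvGen.rel _ _ ⟨hx, hy, i, hi⟩
    | refl x => exact Setoid.refl' _ _
    | symm _ _ _ ih => exact Setoid.symm' _ ih
    | trans _ _ _ _ _ ih1 ih2 => exact Setoid.trans' _ ih1 ih2
  have hsup : ∀ x y, clusters W c x y → ¬ clusters W c T x → clusters W (detach T c) x y := by
    intro x y h
    induction h with
    | rel x y h =>
      intro hT
      obtain ⟨hx, hy, i, hi⟩ := h
      have hxT : x ≠ T := by
        rintro rfl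
        exact hT (Setoid.refl' _ _)
      exact Relation.EqvGen.rel _ _ ⟨hx, hy, i, by simpa [detach, hxT] using hi⟩
    | refl x => exact fun _ => Setoid.refl' _ _
    | symm x y h ih => exact fun hT => Setoid.symm' _ (ih fun h' => hT (Setoid.trans' _ h' h))
    | trans x y z h1 _ ih1 ih2 =>
      exact fun hT => Setoid.trans' _ (ih1 hT)
        (ih2 fun h' => hT (Setoid.trans' _ h' (Setoid.symm' _ h1)))
  have hcls : cls (clusters W (detach T c)) p = cls (clusters W c) p := by
    ext q
    rw [mem_cls, mem_cls]
    exact ⟨hsub p q, fun h => hsup p q h hp⟩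
  have hlast : lastOf W (detach T c) p = lastOf W c p := by
    unfold lastOf
    congr 1
  have hne : lastOf W c p ≠ T := by
    intro h
    have := Finset.max'_mem (cls (clusters W c) p) ⟨p, self_mem_cls _ p⟩
    rw [mem_cls] at this
    exact hp (Setoid.symm' _ (h ▸ this))
  rw [hlast]
  funext i
  simp [row, detach, hne]

end Last

section Average

variable {a : Fin (N + 2) → ℝ} {s T : Fin (N + 2)} {X : (Fin m → Option (Fin m)) → ℝ} {M : ℝ}

open Classical in
/-- The value of `X` at the last vertex `T` is almost uncorrelated with its values at the last
vertices of the clusters, as only the cluster of `T` depends on the choices of `T`. -/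
theorem abs_sum_mass_mul_lastOf_le (ha : ∀ r, 0 < a r)
    (hM : ∀ o, |X o| ≤ M) (W : Finset (Fin (N + 2)))
    (hX : ∀ G : (Slot N m → Choice N m) → ℝ, (∀ c i k, G (Function.update c (T, i) k) = G c) →
      ∑ c, mass a c * (X (row c T) * G c) = 0) (p : Fin (N + 2)) :
    |∑ c, mass a c * (X (row c T) * X (row c (lastOf W c p)))| ≤
      ∑ c : Slot N m → Choice N m, mass a c * (2 * M ^ 2 * if clusters W c T p then 1 else 0) := by
  set G : (Slot N m → Choice N m) → ℝ := fun c =>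
    X (row (detach T c) (lastOf W (detach T c) p)) with hG
  have hGi : ∀ c i k, G (Function.update c (T, i) k) = G c := by
    intro c i k
    have : detach T (Function.update c (T, i) k) = detach T c := by
      funext e
      by_cases he : e.1 = T
      · simp [detach, he]
      · have : e ≠ (T, i) := fun h => he (by rw [h])
        simp [detach, he, Function.update_of_ne this]
    simp only [hG, this]
  have h0 := hX G hGi
  have h1 : ∑ c, mass a c * (X (row c T) * X (row c (lastOf W c p))) =
      ∑ c, mass a c * (X (row c T) * (X (row c (lastOf W c p)) - G c)) := by
    simp_rw [mul_sub, Finset.sum_sub_distrib]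
    rw [h0, sub_zero]
  rw [h1]
  refine (Finset.abs_sum_le_sum_abs _ _).trans (Finset.sum_le_sum fun c _ => ?_)
  rw [abs_mul, abs_of_nonneg (mass_nonneg ha c), abs_mul]
  refine mul_le_mul_of_nonneg_left ?_ (mass_nonneg ha c)
  by_cases h : clusters W c T p
  · rw [if_pos h, mul_one]
    have h2 : |X (row c (lastOf W c p)) - G c| ≤ M + M :=
      (abs_sub _ _).trans (add_le_add (hM _) (hM _))
    have h3 := mul_le_mul (hM (row c T)) h2 (abs_nonneg _) ((abs_nonneg _).trans (hM (row c T)))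
    linarith
  · rw [if_neg h, hG]
    simp only
    rw [row_lastOf_detach h]
    simp

/-- A centred function `X` of the choices of the last vertex `T` of a short time window is almost
uncorrelated with every function of the snapshot. Since exchanging the arrival times of clusters is
not visible in the snapshot, `X` may be replaced by its average over the last vertices of the
clusters, whose variance is of the order of the inverse length of the window. -/
theorem abs_sum_mass_mul_le (ha : ∀ r, 0 < a r) (hs : 2 ≤ s.val) (hsT : s ≤ T)
    (haW : ∀ r ∈ Finset.Icc s T, a r = a T) (hM : ∀ o, |X o| ≤ M)
    (hX : ∀ G : (Slot N m → Choice N m) → ℝ, (∀ c i k, G (Function.update c (T, i) k) = G c) →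
      ∑ c, mass a c * (X (row c T) * G c) = 0)
    {q : ℝ} (hq : ∀ e : Slot N m, e.1 ∈ Finset.Icc s T → ∀ w ∈ Finset.Icc s T, w ≠ e.1 →
      ∑ k, prob a e k * (if k.1 = w then 1 else 0) ≤ q)
    (hW : ((Finset.Icc s T).card : ℝ) * (m * q) ≤ 1 / 4)
    (f : (Slot N m → Choice N m) → ℝ) (hf : ∀ c, |f c| ≤ 1)
    (hfπ : ∀ π : Equiv.Perm (Fin (N + 2)), (∀ p ∉ Finset.Icc s T, π p = p) → ∀ c,
      f (relabel (Finset.Icc s T) π c) = f c) :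
    |∑ c, mass a c * (X (row c T) * f c)| ≤ 2 * M / Real.sqrt (Finset.Icc s T).card := by
  classical
  set W := Finset.Icc s T with hWdef
  have hTW : T ∈ W := Finset.mem_Icc.2 ⟨hsT, le_rfl⟩
  set κ : ℝ := (W.card : ℝ) with hκ
  have hκ0 : 0 < κ := by
    rw [hκ]; exact_mod_cast Finset.card_pos.2 ⟨T, hTW⟩
  have hM0 : 0 ≤ M := (abs_nonneg _).trans (hM fun _ => none)
  -- The values of `X` at the last vertices of the clusters, and their average over the window.
  set z : Fin (N + 2) → (Slot N m → Choice N m) → ℝ := fun p c => X (row c (lastOf W c p)) with hz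
  set Z : (Slot N m → Choice N m) → ℝ := fun c => κ⁻¹ * ∑ p ∈ W, z p c with hZ
  have hzT : ∀ c, z T c = X (row c T) := fun c => by simp only [hz, hWdef, lastOf_top]
  have hzπ : ∀ π : Equiv.Perm (Fin (N + 2)), (∀ p ∉ W, π p = p) → ∀ p c,
      z (π p) (relabel W π c) = z p c := fun π hπ p c => by
    simp only [hz, row_lastOf_relabel hπ]
  have hswap : ∀ p ∈ W, ∀ x ∉ W, Equiv.swap p T x = x := fun p hp x hx =>
    Equiv.swap_apply_of_ne_of_ne (fun h => hx (h ▸ hp)) (fun h => hx (h ▸ hTW))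
  -- The transposition of `p` and `T` gives the cluster of `p` the last arrival time.
  have hexch : ∀ F : (Slot N m → Choice N m) → ℝ,
      (∀ π : Equiv.Perm (Fin (N + 2)), (∀ p ∉ W, π p = p) → ∀ c, F (relabel W π c) = F c) →
      ∀ p ∈ W, ∑ c, mass a c * (z p c * F c) = ∑ c, mass a c * (z T c * F c) := by
    intro F hF p hp
    rw [← sum_mass_relabel hs (hswap p hp) haW fun c => z T c * F c]
    refine Finset.sum_congr rfl fun c _ => ?_
    have := hzπ _ (hswap p hp) p c
    rw [Equiv.swap_apply_left] at this
    rw [this, hF _ (hswap p hp)]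
  have havg : ∀ F : (Slot N m → Choice N m) → ℝ,
      (∀ π : Equiv.Perm (Fin (N + 2)), (∀ p ∉ W, π p = p) → ∀ c, F (relabel W π c) = F c) →
      ∑ c, mass a c * (Z c * F c) = ∑ c, mass a c * (z T c * F c) := by
    intro F hF
    calc ∑ c, mass a c * (Z c * F c) = κ⁻¹ * ∑ p ∈ W, ∑ c, mass a c * (z p c * F c) := by
          rw [Finset.sum_comm, Finset.mul_sum]
          refine Finset.sum_congr rfl fun c _ => ?_
          simp only [hZ]
          rw [← Finset.mul_sum, ← Finset.sum_mul]
          ring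
      _ = κ⁻¹ * (κ * ∑ c, mass a c * (z T c * F c)) := by
          rw [Finset.sum_congr rfl (hexch F hF), Finset.sum_const, nsmul_eq_mul]
      _ = _ := by rw [← mul_assoc, inv_mul_cancel₀ hκ0.ne', one_mul]
  have hZπ : ∀ π : Equiv.Perm (Fin (N + 2)), (∀ p ∉ W, π p = p) → ∀ c,
      Z (relabel W π c) = Z c := by
    intro π hπ c
    simp only [hZ]
    congr 1
    refine (Finset.sum_equiv π (fun p => ?_) fun p _ => (hzπ π hπ p c).symm).symm
    constructor
    · intro hp
      by_contra h
      exact h ((π.injective (hπ _ h)).symm ▸ hp)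
    · intro hp
      by_contra h
      rw [hπ p h] at hp
      exact h hp
  have hvar : ∑ c, mass a c * (Z c * Z c) ≤ 4 * M ^ 2 / κ := by
    rw [havg Z hZπ]
    have h1 : ∑ c, mass a c * (z T c * Z c) = κ⁻¹ * ∑ p ∈ W, ∑ c, mass a c * (z T c * z p c) := by
      rw [Finset.sum_comm, Finset.mul_sum]
      refine Finset.sum_congr rfl fun c _ => ?_
      simp only [hZ]
      rw [← Finset.mul_sum, ← Finset.mul_sum]
      ring
    have h2 : ∑ c, mass a c * (z T c * z T c) ≤ M ^ 2 := by
      calc ∑ c, mass a c * (z T c * z T c) ≤ ∑ c : Slot N m → Choice N m, mass a c * M ^ 2 := by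
            refine Finset.sum_le_sum fun c _ => mul_le_mul_of_nonneg_left ?_ (mass_nonneg ha c)
            rw [← sq, ← sq_abs]
            exact pow_le_pow_left₀ (abs_nonneg _) (hM _) 2
        _ = M ^ 2 := by rw [← Finset.sum_mul, sum_mass m ha, one_mul]
    -- The covariances add up to at most `2 M ^ 2` times the expected number of further vertices in
    -- the cluster of `T`.
    have h3 : ∑ p ∈ W.erase T, ∑ c, mass a c * (z T c * z p c) ≤ 2 * M ^ 2 := by
      calc ∑ p ∈ W.erase T, ∑ c, mass a c * (z T c * z p c)
          ≤ ∑ p ∈ W.erase T, ∑ c : Slot N m → Choice N m,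
              mass a c * (2 * M ^ 2 * if clusters W c T p then 1 else 0) := by
            refine Finset.sum_le_sum fun p _ => ?_
            have := abs_sum_mass_mul_lastOf_le ha hM W hX p
            simp only [hzT]
            exact (le_abs_self _).trans this
        _ = 2 * M ^ 2 * ∑ c : Slot N m → Choice N m,
              mass a c * ∑ p ∈ W.erase T, if clusters W c T p then 1 else 0 := by
            rw [Finset.sum_comm, Finset.mul_sum]
            refine Finset.sum_congr rfl fun c _ => ?_
            rw [← Finset.mul_sum, ← Finset.mul_sum]
            ring
        _ ≤ 2 * M ^ 2 * 1 := by
            refine mul_le_mul_of_nonneg_left ?_ (by positivity)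
            refine le_trans (Finset.sum_le_sum fun c _ => mul_le_mul_of_nonneg_left ?_
              (mass_nonneg ha c)) (sum_mass_card_cluster_le (m := m) ha hq hW T hTW)
            rw [Finset.sum_boole]
            refine Nat.cast_le.2 (Finset.card_le_card fun p hp => ?_)
            simp only [Finset.mem_filter, Finset.mem_erase, Finset.mem_univ, true_and] at hp ⊢
            exact ⟨hp.1.1, hp.2⟩
        _ = _ := mul_one _
    rw [h1, ← Finset.add_sum_erase W _ hTW, div_eq_inv_mul]
    refine mul_le_mul_of_nonneg_left ?_ (inv_nonneg.2 hκ0.le)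
    nlinarith [sq_nonneg M]
  have hzf : ∑ c, mass a c * (X (row c T) * f c) = ∑ c, mass a c * (Z c * f c) := by
    rw [havg f hfπ]
    simp only [hzT]
  rw [hzf]
  have hCS : (∑ c, mass a c * |Z c|) ^ 2 ≤ ∑ c, mass a c * (Z c * Z c) := by
    have := Finset.sum_mul_sq_le_sq_mul_sq Finset.univ
      (fun c : Slot N m → Choice N m => Real.sqrt (mass a c))
      (fun c => Real.sqrt (mass a c) * |Z c|)
    have hsq : ∀ c : Slot N m → Choice N m, Real.sqrt (mass a c) ^ 2 = mass a c := fun c =>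
      Real.sq_sqrt (mass_nonneg ha c)
    simp only [mul_pow, hsq, sum_mass m ha, one_mul, sq_abs, ← mul_assoc, ← sq] at this ⊢
    exact this
  have hle : |∑ c, mass a c * (Z c * f c)| ≤ ∑ c, mass a c * |Z c| := by
    refine (Finset.abs_sum_le_sum_abs _ _).trans (Finset.sum_le_sum fun c _ => ?_)
    rw [abs_mul, abs_of_nonneg (mass_nonneg ha c), abs_mul]
    refine mul_le_mul_of_nonneg_left ?_ (mass_nonneg ha c)
    exact mul_le_of_le_one_right (abs_nonneg _) (hf c)
  refine hle.trans ((le_abs_self _).trans (abs_le_of_sq_le_sq ?_ (by positivity)))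
  rw [div_pow, Real.sq_sqrt hκ0.le]
  calc _ ≤ _ := hCS
    _ ≤ _ := hvar
    _ = _ := by ring

end Average

/-! ### Changing the parameter of a single vertex -/

section Density

variable {a : Fin (N + 2) → ℝ} {T : Fin (N + 2)} {b : ℝ}

/-- The density of the choice at the slot `(T, i)` when the parameter of the vertex `T` is changed
to `b`. It depends on the choice only through its type, vertex or edge. -/
noncomputable def slotDensity (a : Fin (N + 2) → ℝ) (T : Fin (N + 2)) (b : ℝ) (i : Fin m)
    (o : Option (Fin m)) : ℝ :=
  (if o = none then b / a T else 1) *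
    (totalWeight a (T, i) / totalWeight (Function.update a T b) (T, i))

/-- The density, minus one, of all choices of the vertex `T` when its parameter is changed to
`b`. -/
noncomputable def rowDensity (a : Fin (N + 2) → ℝ) (T : Fin (N + 2)) (b : ℝ)
    (o : Fin m → Option (Fin m)) : ℝ :=
  (∏ i, slotDensity a T b i (o i)) - 1

theorem update_pos (ha : ∀ r, 0 < a r) (hb : 0 < b) (r : Fin (N + 2)) :
    0 < Function.update a T b r := by
  by_cases h : r = T
  · rw [h, Function.update_self]
    exact hb
  · rw [Function.update_of_ne h]
    exact ha r

theorem prob_update_self (ha : ∀ r, 0 < a r) (i : Fin m) (k : Choice N m) :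
    prob (Function.update a T b) (T, i) k = prob a (T, i) k * slotDensity a T b i k.2 := by
  have h1 := (totalWeight_pos ha (T, i)).ne'
  have h2 := (ha T).ne'
  have h3 : weight (Function.update a T b) (T, i) k =
      weight a (T, i) k * (if k.2 = none then b / a T else 1) := by
    unfold weight
    by_cases hk : Admissible (T, i) k
    · by_cases ho : k.2 = none
      · simp only [hk, ho, if_true, Function.update_self]
        field_simp
      · simp [hk, ho]
    · simp [hk]
  unfold prob slotDensity
  rw [h3]
  field_simp

theorem prob_update_of_ne {e : Slot N m} (he : e.1 ≠ T) (k : Choice N m) :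
    prob (Function.update a T b) e k = prob a e k := by
  have : ∀ k, weight (Function.update a T b) e k = weight a e k := by
    intro k
    unfold weight
    rw [Function.update_of_ne he]
  unfold prob totalWeight
  simp only [this]

theorem mass_update (ha : ∀ r, 0 < a r) (c : Slot N m → Choice N m) :
    mass (Function.update a T b) c = mass a c * (1 + rowDensity a T b (row c T)) := by
  unfold mass rowDensity
  rw [Fintype.prod_prod_type, Fintype.prod_prod_type, ← Finset.mul_prod_erase _ _
    (Finset.mem_univ T), ← Finset.mul_prod_erase _ (fun r => ∏ i, prob a (r, i) (c (r, i)))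
    (Finset.mem_univ T)]
  have h1 : ∏ r ∈ Finset.univ.erase T, ∏ i, prob (Function.update a T b) (r, i) (c (r, i)) =
      ∏ r ∈ Finset.univ.erase T, ∏ i, prob a (r, i) (c (r, i)) :=
    Finset.prod_congr rfl fun r hr => Finset.prod_congr rfl fun i _ =>
      prob_update_of_ne (Finset.ne_of_mem_erase hr) _
  simp only [h1, prob_update_self ha, Finset.prod_mul_distrib, row]
  ring

/-- The density of the changed row is centred given all other choices. -/
theorem sum_mass_rowDensity (ha : ∀ r, 0 < a r) (hb : 0 < b)
    (G : (Slot N m → Choice N m) → ℝ) (hG : ∀ c i k, G (Function.update c (T, i) k) = G c) :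
    ∑ c, mass a c * (rowDensity a T b (row c T) * G c) = 0 := by
  classical
  have key : ∀ I : Finset (Fin m), ∑ c, mass a c *
      ((∏ i ∈ I, slotDensity a T b i (row c T i)) * G c) = ∑ c, mass a c * G c := by
    intro I
    induction I using Finset.induction_on with
    | empty => simp
    | insert j I hj ih =>
      have h := sum_mass_mul_slot ha (T, j) (fun k => slotDensity a T b j k.2)
        (fun c => (∏ i ∈ I, slotDensity a T b i (row c T i)) * G c) (by
          intro c k
          rw [hG]
          congr 1
          refine Finset.prod_congr rfl fun i hi => ?_
          have : ((T, i) : Slot N m) ≠ (T, j) := fun h => hj ((Prod.mk.inj h).2 ▸ hi)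
          rw [row, Function.update_of_ne this, row])
      have h1 : ∑ k, prob a (T, j) k * slotDensity a T b j k.2 = 1 := by
        simp_rw [← prob_update_self ha]
        exact sum_prob (update_pos ha hb) _
      rw [h1, one_mul, ih] at h
      rw [← h]
      refine Finset.sum_congr rfl fun c _ => ?_
      rw [Finset.prod_insert hj, mul_assoc]
      rfl
  have h := key Finset.univ
  simp only [rowDensity, sub_mul, one_mul, mul_sub, Finset.sum_sub_distrib]
  rw [h, sub_self]

theorem weight_le_update (hb : 0 < b) (i : Fin m) (k : Choice N m) :
    weight a (T, i) k ≤ max 1 (a T / b) * weight (Function.update a T b) (T, i) k := by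
  unfold weight
  have h1 := le_max_left 1 (a T / b)
  have h2 := le_max_right 1 (a T / b)
  split_ifs
  · rw [Function.update_self]
    rw [div_le_iff₀ hb] at h2
    exact h2
  · rw [mul_one]
    exact h1
  · simp

/-- A bound for the density of a row when the weight of a vertex is changed from `x` to `y`. -/
noncomputable def densityBound (m : ℕ) (x y : ℝ) : ℝ := (max 1 (y / x) * max 1 (x / y)) ^ m

theorem abs_rowDensity_le (ha : ∀ r, 0 < a r) (hb : 0 < b) (o : Fin m → Option (Fin m)) :
    |rowDensity a T b o| ≤ densityBound m (a T) b := by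
  have h0 : ∀ i, 0 ≤ slotDensity a T b i (o i) := by
    intro i
    refine mul_nonneg ?_ (div_nonneg (totalWeight_pos ha _).le
      (totalWeight_pos (update_pos ha hb) _).le)
    split_ifs
    · exact (div_pos hb (ha T)).le
    · exact zero_le_one
  have h1 : ∀ i, slotDensity a T b i (o i) ≤ max 1 (b / a T) * max 1 (a T / b) := by
    intro i
    refine mul_le_mul ?_ ?_ (div_nonneg (totalWeight_pos ha _).le
      (totalWeight_pos (update_pos ha hb) _).le) (zero_le_one.trans (le_max_left _ _))
    · split_ifs
      · exact le_max_right _ _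
      · exact le_max_left _ _
    · rw [div_le_iff₀ (totalWeight_pos (update_pos ha hb) _)]
      unfold totalWeight
      rw [Finset.mul_sum]
      exact Finset.sum_le_sum fun k _ => weight_le_update hb i k
  have h2 : ∏ i, slotDensity a T b i (o i) ≤ densityBound m (a T) b := by
    refine (Finset.prod_le_prod (fun i _ => h0 i) fun i _ => h1 i).trans ?_
    simp [densityBound]
  have h3 : 0 ≤ ∏ i, slotDensity a T b i (o i) := Finset.prod_nonneg fun i _ => h0 i
  have h4 : 1 ≤ densityBound m (a T) b :=
    one_le_pow₀ (one_le_mul_of_one_le_of_one_le (le_max_left _ _) (le_max_left _ _))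
  rw [rowDensity, abs_le]
  constructor <;> linarith

end Density

/-- A slot points to a given vertex with probability of the order of the inverse arrival time. -/
theorem sum_prob_point_le {a : Fin (N + 2) → ℝ} (ha : ∀ r, 0 < a r) {s : ℕ} (hs : 2 ≤ s)
    (e : Slot N m) (he : s ≤ e.1.val) (w : Fin (N + 2)) :
    ∑ k, prob a e k * (if k.1 = w then 1 else 0) ≤ (a e.1 + m) / (s * a e.1) := by
  have hpos := ha e.1
  have hs0 : (0 : ℝ) < s := by exact_mod_cast (by omega : 0 < s)
  have h1 : s * a e.1 ≤ totalWeight a e := by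
    have h2 : ∀ j < e.1, weight a e (j, none) = a e.1 := by
      intro j hj
      have : Admissible e (j, none) := Or.inr ⟨hs.trans he, Or.inl ⟨rfl, hj⟩⟩
      simp [weight, this]
    calc s * a e.1 ≤ e.1.val * a e.1 :=
          mul_le_mul_of_nonneg_right (by exact_mod_cast he) hpos.le
      _ = ∑ j ∈ Finset.Iio e.1, weight a e (j, none) := by
          rw [Finset.sum_congr rfl fun j hj => h2 j (Finset.mem_Iio.1 hj), Finset.sum_const,
            nsmul_eq_mul, Fin.card_Iio]
      _ ≤ ∑ j, weight a e (j, none) :=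
          Finset.sum_le_sum_of_subset_of_nonneg (Finset.subset_univ _) fun j _ _ =>
            weight_nonneg ha e _
      _ ≤ totalWeight a e := by
          rw [totalWeight, Fintype.sum_prod_type]
          refine Finset.sum_le_sum fun j _ => ?_
          rw [Fintype.sum_option]
          have : 0 ≤ ∑ i, weight a e (j, some i) :=
            Finset.sum_nonneg fun i _ => weight_nonneg ha e _
          linarith
  have h3 : ∑ k, prob a e k * (if k.1 = w then 1 else 0) =
      (∑ o, weight a e (w, o)) / totalWeight a e := by
    rw [Fintype.sum_prod_type, Finset.sum_div]
    rw [Finset.sum_eq_single w]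
    · simp [prob]
    · intro j _ hj
      simp [hj]
    · simp
  have h4 : ∑ o, weight a e (w, o) ≤ a e.1 + m := by
    rw [Fintype.sum_option]
    refine add_le_add ?_ ?_
    · unfold weight
      split_ifs <;> simp_all [hpos.le]
    · calc ∑ i, weight a e (w, some i) ≤ ∑ _i : Fin m, (1 : ℝ) := by
            refine Finset.sum_le_sum fun i _ => ?_
            unfold weight
            split_ifs
            · simp at *
            · exact le_rfl
            · exact zero_le_one
        _ = m := by simp
  rw [h3]
  exact div_le_div₀ (by positivity) h4 (by positivity) h1

/-! ### Total variation distance -/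

theorem summable_toReal {α : Type*} (p : PMF α) : Summable fun x => (p x).toReal :=
  ENNReal.summable_toReal p.tsum_coe_ne_top

theorem tvDist_nonneg {α : Type*} (p q : PMF α) : 0 ≤ tvDist p q :=
  mul_nonneg (by norm_num) (tsum_nonneg fun _ => abs_nonneg _)

theorem tvDist_self {α : Type*} (p : PMF α) : tvDist p p = 0 := by simp [tvDist]

theorem tvDist_triangle {α : Type*} (p q r : PMF α) : tvDist p r ≤ tvDist p q + tvDist q r := by
  unfold tvDist
  have h1 := ((summable_toReal p).sub (summable_toReal q)).abs
  have h2 := ((summable_toReal q).sub (summable_toReal r)).abs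
  have h3 := ((summable_toReal p).sub (summable_toReal r)).abs
  rw [← mul_add, ← h1.tsum_add h2]
  refine mul_le_mul_of_nonneg_left (h3.tsum_le_tsum (fun x => ?_) (h1.add h2)) (by norm_num)
  exact abs_sub_le _ _ _

/-- The sum of the errors of a test differs from `1` by at most twice the total variation
distance. -/
theorem abs_errors_sub_one_le {α : Type*} (p q : PMF α) (φ : α → ℝ)
    (hφ : ∀ x, 0 ≤ φ x ∧ φ x ≤ 1) :
    |typeIError p φ + typeIIError q φ - 1| ≤ 2 * tvDist p q := by
  have hq1 : ∑' x, (q x).toReal = 1 := by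
    rw [← ENNReal.tsum_toReal_eq fun x => q.apply_ne_top x, q.tsum_coe, ENNReal.toReal_one]
  have hs : ∀ r : PMF α, Summable fun x => (r x).toReal * φ x := fun r =>
    Summable.of_nonneg_of_le (fun x => mul_nonneg ENNReal.toReal_nonneg (hφ x).1)
      (fun x => mul_le_of_le_one_right ENNReal.toReal_nonneg (hφ x).2) (summable_toReal r)
  have h1 : typeIIError q φ = 1 - ∑' x, (q x).toReal * φ x := by
    rw [typeIIError]
    simp_rw [mul_sub, mul_one]
    rw [(summable_toReal q).tsum_sub (hs q), hq1]
  have h2 : typeIError p φ + typeIIError q φ - 1 =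
      ∑' x, ((p x).toReal - (q x).toReal) * φ x := by
    rw [h1, typeIError]
    simp_rw [sub_mul]
    rw [(hs p).tsum_sub (hs q)]
    ring
  have h3 := ((summable_toReal p).sub (summable_toReal q)).abs
  have h4 : ∀ x, |((p x).toReal - (q x).toReal) * φ x| ≤ |(p x).toReal - (q x).toReal| := by
    intro x
    rw [abs_mul, abs_of_nonneg (hφ x).1]
    exact mul_le_of_le_one_right (abs_nonneg _) (hφ x).2
  have h5 : Summable fun x => |((p x).toReal - (q x).toReal) * φ x| :=
    Summable.of_nonneg_of_le (fun _ => abs_nonneg _) h4 h3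
  rw [h2, tvDist, ← mul_assoc]
  norm_num
  have h6 : ‖∑' x, ((p x).toReal - (q x).toReal) * φ x‖ ≤
      ∑' x, ‖((p x).toReal - (q x).toReal) * φ x‖ := norm_tsum_le_tsum_norm h5
  simp only [Real.norm_eq_abs] at h6
  exact h6.trans (h5.tsum_le_tsum h4 h3)

section StepBound

variable {V : Type*} [DecidableEq V] [Fintype (Fin (N + 2) ≃ V)] [Nonempty (Fin (N + 2) ≃ V)]

/-- The law of the final snapshot of a random attachment structure with uniformly random labels,
when the vertex `r` reaches a vertex of in-degree zero with weight `a r`. -/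
noncomputable def snapshotLaw (V : Type*) [DecidableEq V] [Fintype (Fin (N + 2) ≃ V)]
    [Nonempty (Fin (N + 2) ≃ V)] (m : ℕ) {a : Fin (N + 2) → ℝ} (ha : ∀ r, 0 < a r) :
    PMF (PAGraph V) :=
  (PMF.uniformOfFintype (Fin (N + 2) ≃ V)).bind fun l =>
    (structPMF m ha).map fun c => snapshot l c (N + 2)

open Classical in
theorem toReal_snapshotLaw {a : Fin (N + 2) → ℝ} (ha : ∀ r, 0 < a r) (G : PAGraph V) :
    (snapshotLaw V m ha G).toReal = ∑ x : (Fin (N + 2) ≃ V) × (Slot N m → Choice N m),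
      if G = snapshot x.1 x.2 (N + 2) then
        (Fintype.card (Fin (N + 2) ≃ V) : ℝ)⁻¹ * mass a x.2 else 0 := by
  have hm : ∀ c : Slot N m → Choice N m, (structPMF m ha c) = ENNReal.ofReal (mass a c) := by
    intro c
    rw [structPMF, productPMF_apply, mass, ENNReal.ofReal_prod_of_nonneg fun e _ =>
      prob_nonneg ha e _]
    rfl
  have hl : (Fintype.card (Fin (N + 2) ≃ V) : ENNReal) ≠ 0 := by
    exact_mod_cast Fintype.card_ne_zero
  rw [snapshotLaw, PMF.bind_apply, tsum_fintype, Fintype.sum_prod_type, ENNReal.toReal_sum]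
  · refine Finset.sum_congr rfl fun l _ => ?_
    rw [ENNReal.toReal_mul, PMF.uniformOfFintype_apply, PMF.map_apply, tsum_fintype,
      ENNReal.toReal_sum, ENNReal.toReal_inv, ENNReal.toReal_natCast, Finset.mul_sum]
    · refine Finset.sum_congr rfl fun c _ => ?_
      split_ifs
      · rw [hm, ENNReal.toReal_ofReal (mass_nonneg ha c)]
      · simp
    · intro c _
      split_ifs
      · exact PMF.apply_ne_top _ _
      · exact ENNReal.zero_ne_top
  · intro l _
    exact ENNReal.mul_ne_top (PMF.apply_ne_top _ _) (PMF.apply_ne_top _ _)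

/-- The total variation distance caused by changing the parameter of the single vertex `T`. -/
theorem tvDist_snapshotLaw_le {a : Fin (N + 2) → ℝ} (ha : ∀ r, 0 < a r) {s T : Fin (N + 2)}
    (hs : 2 ≤ s.val) (hsT : s ≤ T) (haW : ∀ r ∈ Finset.Icc s T, a r = a T) {b : ℝ} (hb : 0 < b)
    (ha' : ∀ r, 0 < Function.update a T b r)
    (hW : ((Finset.Icc s T).card : ℝ) * (m * ((a T + m) / (s.val * a T))) ≤ 1 / 4) :
    tvDist (snapshotLaw V m ha) (snapshotLaw V m ha') ≤
      densityBound m (a T) b / Real.sqrt (Finset.Icc s T).card := by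
  classical
  set L : ℝ := (Fintype.card (Fin (N + 2) ≃ V) : ℝ) with hL
  have hL0 : 0 < L := by rw [hL]; exact_mod_cast Fintype.card_pos
  -- The sign of the difference of the two laws turns the distance into a difference of expectations.
  set φ : PAGraph V → ℝ := fun G =>
    if 0 ≤ (snapshotLaw V m ha G).toReal - (snapshotLaw V m ha' G).toReal then 1 else -1 with hφ
  have hφ1 : ∀ G, |φ G| ≤ 1 := by
    intro G
    simp only [hφ]
    split_ifs <;> simp
  -- Averaging over the labels makes the test function blind to exchanges of arrival times.
  set f : (Slot N m → Choice N m) → ℝ := fun c =>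
    L⁻¹ * ∑ l : Fin (N + 2) ≃ V, φ (snapshot l c (N + 2)) with hf
  have hf1 : ∀ c, |f c| ≤ 1 := by
    intro c
    simp only [hf]
    rw [abs_mul, abs_of_pos (inv_pos.2 hL0), inv_mul_le_iff₀ hL0, mul_one]
    refine (Finset.abs_sum_le_sum_abs _ _).trans ((Finset.sum_le_sum fun l _ => hφ1 _).trans ?_)
    simp [hL]
  have hfπ : ∀ π : Equiv.Perm (Fin (N + 2)), (∀ p ∉ Finset.Icc s T, π p = p) → ∀ c,
      f (relabel (Finset.Icc s T) π c) = f c := by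
    intro π hπ c
    simp only [hf]
    congr 1
    refine Finset.sum_bij' (fun l _ => (arrival (Finset.Icc s T) π c).trans l)
      (fun l _ => (arrival (Finset.Icc s T) π c).symm.trans l) (by simp) (by simp) ?_ ?_ ?_
    · intro l _; ext; simp
    · intro l _; ext; simp
    · intro l _
      rw [← snapshot_relabel hs hπ ((arrival (Finset.Icc s T) π c).trans l)]
      congr 2
      ext; simp
  have hsum : ∑' G, |(snapshotLaw V m ha G).toReal - (snapshotLaw V m ha' G).toReal| ≤
      |∑ c, mass a c * (rowDensity a T b (row c T) * f c)| := by
    have h1 : ∀ G, |(snapshotLaw V m ha G).toReal - (snapshotLaw V m ha' G).toReal| =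
        ∑ x : (Fin (N + 2) ≃ V) × (Slot N m → Choice N m), if G = snapshot x.1 x.2 (N + 2) then
          L⁻¹ * (mass a x.2 - mass (Function.update a T b) x.2) *
            φ (snapshot x.1 x.2 (N + 2)) else 0 := by
      intro G
      have h2 : |(snapshotLaw V m ha G).toReal - (snapshotLaw V m ha' G).toReal| =
          ((snapshotLaw V m ha G).toReal - (snapshotLaw V m ha' G).toReal) * φ G := by
        simp only [hφ]
        split_ifs with h
        · rw [abs_of_nonneg h, mul_one]
        · rw [abs_of_neg (not_le.1 h), mul_neg_one]
      rw [h2, toReal_snapshotLaw ha, toReal_snapshotLaw ha', ← Finset.sum_sub_distrib,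
        Finset.sum_mul]
      refine Finset.sum_congr rfl fun x _ => ?_
      split_ifs with h
      · rw [h]; ring
      · ring
    simp_rw [h1]
    rw [tsum_eq_sum (s := Finset.univ.image fun x : (Fin (N + 2) ≃ V) × (Slot N m → Choice N m) =>
      snapshot x.1 x.2 (N + 2)), Finset.sum_comm]
    · have h3 : ∀ x : (Fin (N + 2) ≃ V) × (Slot N m → Choice N m),
          snapshot x.1 x.2 (N + 2) ∈ Finset.univ.image
            fun x : (Fin (N + 2) ≃ V) × (Slot N m → Choice N m) => snapshot x.1 x.2 (N + 2) :=
        fun x => Finset.mem_image_of_mem _ (Finset.mem_univ x)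
      simp only [Finset.sum_ite_eq', h3, if_true]
      have h4 : ∑ x : (Fin (N + 2) ≃ V) × (Slot N m → Choice N m),
          L⁻¹ * (mass a x.2 - mass (Function.update a T b) x.2) * φ (snapshot x.1 x.2 (N + 2)) =
          -∑ c, mass a c * (rowDensity a T b (row c T) * f c) := by
        rw [Fintype.sum_prod_type, Finset.sum_comm, ← Finset.sum_neg_distrib]
        refine Finset.sum_congr rfl fun c _ => ?_
        simp only [hf, mass_update ha, ← Finset.mul_sum]
        ring
      rw [h4]
      exact neg_le_abs _
    · intro G hG
      refine Finset.sum_eq_zero fun x _ => if_neg fun h => hG ?_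
      rw [h]
      exact Finset.mem_image_of_mem _ (Finset.mem_univ x)
  rw [tvDist]
  have := abs_sum_mass_mul_le (X := rowDensity a T b) ha hs hsT haW (abs_rowDensity_le ha hb)
    (sum_mass_rowDensity ha hb) (q := (a T + m) / (s.val * a T)) (by
      intro e he w _ _
      rw [← haW _ he]
      exact sum_prob_point_le ha hs e (Finset.mem_Icc.1 he).1 w) hW f hf1 hfπ
  calc _ ≤ 1 / 2 * (2 * densityBound m (a T) b / Real.sqrt (Finset.Icc s T).card) :=
        mul_le_mul_of_nonneg_left (hsum.trans this) (by norm_num)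
    _ = _ := by ring

end StepBound

/-! ### Moving the changepoint -/

theorem paLaw_congr {V : Type*} [Fintype V] [DecidableEq V] {δ δ' : ℕ → ℝ} :
    ∀ t : ℕ, (∀ u ≤ t, δ u = δ' u) → paLaw V m δ t = paLaw V m δ' t
  | 0, _ => rfl
  | 1, _ => rfl
  | 2, _ => rfl
  | t + 3, h => by
    change (paLaw V m δ (t + 2)).bind (paStep m (δ (t + 3))) =
      (paLaw V m δ' (t + 2)).bind (paStep m (δ' (t + 3)))
    rw [paLaw_congr (t + 2) fun u hu => h u (by omega), h _ le_rfl]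

/-- The weight of a vertex of in-degree zero, as seen by the vertex `r`, when the parameter changes
from `δ` to `δ'` at time `τ`. The vertex `r` arrives at time `r + 1`. -/
noncomputable def changepointWeight (N m : ℕ) (δ δ' : ℝ) (τ : ℕ) (r : Fin (N + 2)) : ℝ :=
  m + if r.val + 1 ≤ τ then δ else δ'

section Changepoint

variable {δ δ' : ℝ}

theorem changepointWeight_pos (hδ : -(m : ℝ) < δ) (hδ' : -(m : ℝ) < δ') (τ : ℕ)
    (r : Fin (N + 2)) : 0 < changepointWeight N m δ δ' τ r := by
  unfold changepointWeight
  split_ifs <;> linarith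

theorem changepointLaw_eq {V : Type*} [Fintype V] [DecidableEq V]
    [Nonempty (Fin (N + 2) ≃ V)] (hcard : Fintype.card V = N + 2) (hδ : -(m : ℝ) < δ)
    (hδ' : -(m : ℝ) < δ') (τ : ℕ) :
    changepointLaw V m δ δ' τ =
      snapshotLaw V m (changepointWeight_pos (N := N) hδ hδ' τ) := by
  rw [changepointLaw, hcard]
  exact paLaw_eq hcard (changepointWeight_pos hδ hδ' τ) _ (fun r _ => rfl) N le_rfl

/-- Moving the changepoint by one step to `T` changes the law of the snapshot by `O(1 / √k)` in
total variation, where `k` is any length of a window ending at `T` for which the clusters inside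
the window are small. -/
theorem tvDist_changepointLaw_succ_le {V : Type*} [Fintype V] [DecidableEq V]
    (hcard : Fintype.card V = N + 2) (hδ : -(m : ℝ) < δ) (hδ' : -(m : ℝ) < δ') {T k : ℕ}
    (hT : T < N + 2) (hk : 1 ≤ k) (hkT : k + 1 ≤ T)
    (hW : (k : ℝ) * (m * ((m + δ + m) / (((T + 1 - k : ℕ) : ℝ) * (m + δ)))) ≤ 1 / 4) :
    tvDist (changepointLaw V m δ δ' (T + 1)) (changepointLaw V m δ δ' T) ≤
      densityBound m (m + δ) (m + δ') / Real.sqrt k := by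
  have : Nonempty (Fin (N + 2) ≃ V) := ⟨(Fintype.equivFinOfCardEq hcard).symm⟩
  set T' : Fin (N + 2) := ⟨T, hT⟩ with hT'
  set s : Fin (N + 2) := ⟨T + 1 - k, by omega⟩ with hs
  set a := changepointWeight N m δ δ' (T + 1) with ha
  have hapos : ∀ r, 0 < a r := changepointWeight_pos hδ hδ' (T + 1)
  have haT : ∀ r : Fin (N + 2), r.val ≤ T → a r = m + δ := by
    intro r hr
    simp [ha, changepointWeight, hr]
  have hupd : changepointWeight N m δ δ' T = Function.update a T' (m + δ') := by
    funext r
    by_cases hr : r = T'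
    · subst hr
      simp [changepointWeight, hT']
    · have : r.val ≠ T := fun h => hr (Fin.ext h)
      rw [Function.update_of_ne hr, ha, changepointWeight, changepointWeight]
      congr 1
      exact if_congr (by omega) rfl rfl
  have hcardW : (Finset.Icc s T').card = k := by
    rw [Fin.card_Icc]
    simp only [hs, hT']
    omega
  have hpos' : ∀ r, 0 < Function.update a T' (m + δ') r := by
    rw [← hupd]
    exact changepointWeight_pos hδ hδ' T
  have key := tvDist_snapshotLaw_le (V := V) (m := m) hapos (s := s) (T := T')
    (by simp only [hs]; omega) (by rw [Fin.le_def]; simp only [hs, hT']; omega)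
    (fun r hr => by
      rw [haT r (Fin.le_def.1 (Finset.mem_Icc.1 hr).2), haT T' le_rfl]) (b := m + δ')
    (by linarith) hpos' (by rw [hcardW, haT T' le_rfl]; exact hW)
  rw [hcardW, haT T' le_rfl] at key
  have h2 : changepointLaw V m δ δ' T = snapshotLaw V m hpos' := by
    rw [changepointLaw_eq hcard hδ hδ']
    congr 1
  rw [changepointLaw_eq hcard hδ hδ', h2]
  exact key

/-- Moving the changepoint by one step in the second half of the evolution changes the law of the
snapshot by `O(1 / √n)`. The window may have length proportional to `n`, with a small constant
depending on `m` and `δ`. -/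
theorem exists_tvDist_changepointLaw_succ_le (hm : 1 ≤ m) (hδ : -(m : ℝ) < δ)
    (hδ' : -(m : ℝ) < δ') : ∃ C : ℝ, 0 ≤ C ∧ ∃ n₀ : ℕ, 2 ≤ n₀ ∧ ∀ n : ℕ, n₀ ≤ n →
      ∀ (V : Type*) [Fintype V] [DecidableEq V], Fintype.card V = n → ∀ T : ℕ, T < n → n ≤ 2 * T →
        tvDist (changepointLaw V m δ δ' (T + 1)) (changepointLaw V m δ δ' T) ≤
          C / Real.sqrt n := by
  have hm0 : (1 : ℝ) ≤ m := by exact_mod_cast hm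
  set α : ℝ := m + δ with hα
  have hα0 : 0 < α := by rw [hα]; linarith
  -- With a window of length `k ≤ η n` ending in the second half, all arrival times in the window are
  -- at least `n / 4`, which makes `4 k m q ≤ 1` for the bound `q` of `sum_prob_point_le`.
  set η : ℝ := α / (16 * m * (α + m)) with hη
  have hη0 : 0 < η := by positivity
  have hη1 : η ≤ 1 / 16 := by
    rw [hη, div_le_div_iff₀ (by positivity) (by norm_num)]
    nlinarith
  set B := densityBound m α (m + δ') with hB
  have hB0 : 0 ≤ B := by
    have h1 := le_max_left 1 ((m + δ') / α)
    have h2 := le_max_left 1 (α / (m + δ'))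
    rw [hB, densityBound]
    positivity
  refine ⟨B * Real.sqrt (2 / η), by positivity, max 8 ⌈1 / η⌉₊, by omega, ?_⟩
  intro n hn V _ _ hcard T hTn hnT
  have hn8 : 8 ≤ n := (le_max_left _ _).trans hn
  have hnη : 1 ≤ η * n := by
    have h1 : 1 / η ≤ n := (Nat.le_ceil _).trans (by exact_mod_cast (le_max_right _ _).trans hn)
    rw [div_le_iff₀ hη0] at h1
    linarith
  set k := ⌊η * n⌋₊ with hk
  have hk1 : 1 ≤ k := Nat.one_le_floor_iff _ |>.2 hnη
  have hkle : (k : ℝ) ≤ η * n := Nat.floor_le (by positivity)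
  have hkge : η * n / 2 ≤ k := by
    have h1 := Nat.lt_floor_add_one (η * n)
    have h2 : (1 : ℝ) ≤ k := by exact_mod_cast hk1
    rw [← hk] at h1
    linarith
  have hkn : 16 * k ≤ n := by
    have : (16 : ℝ) * k ≤ n := by
      have : η * n ≤ 1 / 16 * n := mul_le_mul_of_nonneg_right hη1 (Nat.cast_nonneg n)
      linarith
    exact_mod_cast this
  obtain ⟨N, rfl⟩ : ∃ N, n = N + 2 := ⟨n - 2, by omega⟩
  set x := T + 1 - k with hx
  have hx4 : (((N + 2 : ℕ)) : ℝ) ≤ 4 * x := by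
    have : N + 2 ≤ 4 * x := by omega
    exact_mod_cast this
  have hx0 : (0 : ℝ) < x := by
    have : 0 < x := by omega
    exact_mod_cast this
  have hW : (k : ℝ) * (m * ((m + δ + m) / ((x : ℝ) * (m + δ)))) ≤ 1 / 4 := by
    rw [← hα, ← mul_div_assoc, ← mul_div_assoc, div_le_div_iff₀ (by positivity) (by norm_num)]
    have h1 : (k : ℝ) * (16 * m * (α + m)) ≤ α * (N + 2 : ℕ) := by
      have : (k : ℝ) ≤ α * (N + 2 : ℕ) / (16 * m * (α + m)) := by
        refine hkle.trans (le_of_eq ?_)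
        rw [hη]
        ring
      rwa [le_div_iff₀ (by positivity)] at this
    have h2 : α * (N + 2 : ℕ) ≤ α * (4 * x) := mul_le_mul_of_nonneg_left hx4 hα0.le
    nlinarith
  refine (tvDist_changepointLaw_succ_le hcard hδ hδ' hTn hk1 (by omega) hW).trans ?_
  rw [← hα, ← hB, mul_div_assoc, ← Real.sqrt_div' _ (Nat.cast_nonneg _), div_eq_mul_inv,
    ← Real.sqrt_inv]
  refine mul_le_mul_of_nonneg_left (Real.sqrt_le_sqrt ?_) hB0
  rw [div_div, inv_eq_one_div, div_le_div_iff₀ (by exact_mod_cast hk1) (by positivity)]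
  linarith

/-- The total variation distance caused by a changepoint in the second half of the evolution is at
most of the order of the number of vertices after the changepoint, divided by `√n`. -/
theorem tvDist_changepointLaw_le {V : Type*} [Fintype V] [DecidableEq V] {n : ℕ} {C : ℝ}
    (hstep : ∀ T : ℕ, T < n → n ≤ 2 * T →
      tvDist (changepointLaw V m δ δ' (T + 1)) (changepointLaw V m δ δ' T) ≤ C / Real.sqrt n) :
    ∀ d : ℕ, d ≤ n → n ≤ 2 * (n - d) →
      tvDist (changepointLaw V m δ δ' n) (changepointLaw V m δ δ' (n - d)) ≤
        d * (C / Real.sqrt n) := by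
  intro d
  induction d with
  | zero => intro _ _; simp [tvDist_self]
  | succ d ih =>
    intro hd hn
    have h1 := hstep (n - (d + 1)) (by omega) hn
    have h2 := ih (by omega) (by omega)
    have h3 : n - (d + 1) + 1 = n - d := by omega
    rw [h3] at h1
    refine (tvDist_triangle _ (changepointLaw V m δ δ' (n - d)) _).trans ?_
    push_cast
    linarith

theorem changepointLaw_of_le {V : Type*} [Fintype V] [DecidableEq V] {n τ : ℕ}
    (hcard : Fintype.card V = n) (hτ : n ≤ τ) :
    changepointLaw V m δ δ' τ = nullLaw V m δ := by
  rw [changepointLaw, nullLaw]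
  refine paLaw_congr _ fun u hu => if_pos ?_
  omega

end Changepoint

end PrefAttach

open PrefAttach in
theorem theorem1 (m : ℕ) (hm : 1 ≤ m) (δ δ' : ℝ) (hδ : -(m : ℝ) < δ) (hδ' : -(m : ℝ) < δ')
    (V : ℕ → Type*) [∀ n, Fintype (V n)] [∀ n, DecidableEq (V n)]
    (hV : ∀ n, Fintype.card (V n) = n)
    (τ : ℕ → ℕ)
    (hτ : (fun n : ℕ => (n : ℝ) - (τ n : ℝ)) =o[atTop] fun n : ℕ => Real.sqrt (n : ℝ)) :
    Tendsto (fun n : ℕ =>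
        tvDist (changepointLaw (V n) m δ δ' n) (changepointLaw (V n) m δ δ' (τ n)))
      atTop (𝓝 0) ∧
    ∀ φ : (n : ℕ) → PAGraph (V n) → ℝ, (∀ n G, 0 ≤ φ n G ∧ φ n G ≤ 1) →
      Tendsto (fun n : ℕ =>
          typeIError (nullLaw (V n) m δ) (φ n) +
            typeIIError (changepointLaw (V n) m δ δ' (τ n)) (φ n))
        atTop (𝓝 1) := by
  obtain ⟨C, hC, n₀, hn₀, hstep⟩ := exists_tvDist_changepointLaw_succ_le hm hδ hδ'
  have hlim : Tendsto (fun n : ℕ => |((n : ℝ) - τ n) / Real.sqrt n|) atTop (𝓝 0) := by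
    simpa using hτ.tendsto_div_nhds_zero.abs
  have hTV : Tendsto (fun n : ℕ =>
      tvDist (changepointLaw (V n) m δ δ' n) (changepointLaw (V n) m δ δ' (τ n)))
      atTop (𝓝 0) := by
    refine squeeze_zero' (Eventually.of_forall fun n => tvDist_nonneg _ _) ?_
      (by simpa using hlim.const_mul C)
    filter_upwards [hlim.eventually_le_const zero_lt_one, eventually_ge_atTop (max n₀ 4)]
      with n hn hn'
    have hn1 : n₀ ≤ n := (le_max_left _ _).trans hn'
    have hn4 : 4 ≤ n := (le_max_right _ _).trans hn'
    rcases le_total n (τ n) with h | h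
    · rw [changepointLaw_of_le (hV n) h, changepointLaw_of_le (hV n) le_rfl, tvDist_self]
      positivity
    · have hsq : (2 : ℝ) ≤ Real.sqrt n := by
        rw [Real.le_sqrt (by norm_num) (Nat.cast_nonneg n)]
        have : (4 : ℝ) ≤ n := by exact_mod_cast hn4
        linarith
      have hsub : (n : ℝ) - τ n = ((n - τ n : ℕ) : ℝ) := by rw [Nat.cast_sub h]
      have h0 : 0 ≤ ((n : ℝ) - τ n) / Real.sqrt n := by
        rw [hsub]
        positivity
      rw [abs_of_nonneg h0] at hn ⊢
      have hhalf : n ≤ 2 * τ n := by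
        rw [div_le_one (by linarith)] at hn
        have h3 : Real.sqrt n * Real.sqrt n = n := Real.mul_self_sqrt (Nat.cast_nonneg n)
        have : (n : ℝ) ≤ 2 * τ n := by nlinarith
        exact_mod_cast this
      have key := tvDist_changepointLaw_le (hstep n hn1 (V n) (hV n)) (n - τ n) (Nat.sub_le _ _)
        (by omega)
      have hτn : n - (n - τ n) = τ n := by omega
      rw [hτn, ← hsub] at key
      refine key.trans (le_of_eq ?_)
      ring
  refine ⟨hTV, fun φ hφ => ?_⟩
  rw [tendsto_iff_norm_sub_tendsto_zero]
  refine squeeze_zero (fun n => norm_nonneg _) (fun n => ?_) (by simpa using hTV.const_mul 2)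
  rw [Real.norm_eq_abs, ← changepointLaw_of_le (δ' := δ') (hV n) le_rfl]
  exact abs_errors_sub_one_le _ _ _ (hφ n)
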